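/- Let $n\ge 2$, let $S^n=\{u\in\mathbb{R}^{n+1}: u\cdot u=1\}$ carry its round metric, and let $TS^n=\{(u,v)\in\mathbb{R}^{n+1}\times\mathbb{R}^{n+1}: u\cdot u=1,\ u\cdot v=0\}$ be its tangent bundle. For $(u,v)\in TS^n$ and $X\in T_uS^n=u^{\perp}$ let $X^v=(0,X)$ and $X^h=(X,-(v\cdot X)u)$ be the vertical and horizontal lifts of $X$ to $T_{(u,v)}TS^n$ (with respect to the Levi-Civita connection of $S^n$). Let $\mathcal A\subset TS^n$ be open and let $\alpha,\delta,\sigma:\mathcal A\to\mathbb{R}$ be smooth functions with $\alpha\delta-\sigma^2=1$ and $\delta>0$. Let $J_{\delta,\sigma}$ be the isotropic almost complex structure on $\mathcal A$ given by $$J_{\delta,\sigma}X^h=\alpha X^v+\sigma X^h,\qquad J_{\delta,\sigma}X^v=-\sigma X^v-\delta X^h .$$ Put $z=(\sigma+i)/\delta:\mathcal A\to H_+=\{x+iy: y>0\}$ and define $\Phi_z:\mathcal A\to\mathbb{C}^{n+1}\setminus\mathbb{R}^{n+1}$ by $\Phi_z(u,v)=v-z(u,v)\,u$. Then $J_{\delta,\sigma}$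 is integrable on $\mathcal A$ if and only if the image $\Phi_z(\mathcal A)$ is a holomorphic hypersurface in $\mathbb{C}^{n+1}\setminus\mathbb{R}^{n+1}$, i.e. a (not necessarily closed) embedded complex submanifold of complex codimension one: near each of its points it is the zero set of a holomorphic function with nowhere vanishing differential. This holds for both usual meanings of integrability: that $J_{\delta,\sigma}$ is induced by local holomorphic coordinates around every point of $\mathcal A$ (a complex structure), and that the sections over $\mathcal A$ of $T^{(0,1)}=\{X+iJ_{\delta,\sigma}X\}$ are closed under the Lie bracket. -/

import Mathlib

open scoped ContDiff

namespace IsotropicSphere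

/-- Euclidean space `ℝ^{n+1}` with its standard inner product. -/
abbrev RSpace (n : ℕ) : Type := EuclideanSpace ℝ (Fin (n + 1))

/-- The complex space `ℂ^{n+1}`. -/
abbrev CSpace (n : ℕ) : Type := EuclideanSpace ℂ (Fin (n + 1))

/-- The tangent bundle of the unit sphere,
`TS^n = {(u, v) | u ⬝ u = 1, u ⬝ v = 0} ⊆ ℝ^{n+1} × ℝ^{n+1}`, an embedded submanifold. -/
def TS (n : ℕ) : Set (RSpace n × RSpace n) :=
  {p | inner ℝ p.1 p.1 = 1 ∧ inner ℝ p.1 p.2 = 0}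

/-- `A` is an open subset of `TS^n` (for the subspace topology). -/
def IsOpenInTS {n : ℕ} (A : Set (RSpace n × RSpace n)) : Prop :=
  ∃ O : Set (RSpace n × RSpace n), IsOpen O ∧ A = O ∩ TS n

/-- The tangent space of `TS^n` at `p = (u, v)`: the pairs `(ξ, η)` that annihilate the differentials
of `u ⬝ u` and of `u ⬝ v`. -/
def tangentTS {n : ℕ} (p : RSpace n × RSpace n) : Set (RSpace n × RSpace n) :=
  {w | inner ℝ p.1 w.1 = 0 ∧ inner ℝ w.1 p.2 + inner ℝ p.1 w.2 = 0}

/-- The connection map `K : T_{(u,v)} TS^n → T_u S^n` of the Levi-Civita connection of the round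
metric. The Levi-Civita connection of the sphere is the tangential part of the derivative in
`ℝ^{n+1}`, so `K (ξ, η)` is the orthogonal projection of `η` to the orthogonal complement of `u`.
The differential of the bundle projection `TS^n → S^n` is `(ξ, η) ↦ ξ`. -/
noncomputable def connectionMap {n : ℕ} (p w : RSpace n × RSpace n) : RSpace n :=
  w.2 - inner ℝ p.1 w.2 • p.1

/-- The vertical lift `X^v` to a point of `TS^n` of a tangent vector `X` of the sphere. -/
def verticalLift {n : ℕ} (X : RSpace n) : RSpace n × RSpace n := (0, X)

/-- The horizontal lift `X^h` to `p = (u, v)` of a vector `X` tangent to the sphere at `u`: the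
tangent vector that projects to `X` and is annihilated by the connection map. -/
noncomputable def horizontalLift {n : ℕ} (p : RSpace n × RSpace n) (X : RSpace n) :
    RSpace n × RSpace n :=
  (X, -(inner ℝ p.2 X) • p.1)

/-- The isotropic almost complex structure `J_{δ,σ}`:
`J X^h = α X^v + σ X^h` and `J X^v = -σ X^v - δ X^h`, extended linearly to
`w = (π_* w)^h + (K w)^v`. Only its values on tangent vectors at points of `TS^n` are meaningful. -/
noncomputable def isotropicJ {n : ℕ} (α δ σ : RSpace n × RSpace n → ℝ)
    (p w : RSpace n × RSpace n) : RSpace n × RSpace n :=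
  (α p • verticalLift w.1 + σ p • horizontalLift p w.1) +
    (-(σ p) • verticalLift (connectionMap p w) - δ p • horizontalLift p (connectionMap p w))

section Facts

variable {n : ℕ} {p w : RSpace n × RSpace n} {X : RSpace n} {α δ σ : RSpace n × RSpace n → ℝ}

theorem horizontalLift_mem (hp : p ∈ TS n) (hX : inner ℝ p.1 X = 0) :
    horizontalLift p X ∈ tangentTS p := by
  refine ⟨hX, ?_⟩
  have h1 := hp.1
  simp only [horizontalLift, inner_smul_right, h1]
  rw [real_inner_comm]; ring

theorem verticalLift_mem (hX : inner ℝ p.1 X = 0) : verticalLift X ∈ tangentTS p := by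
  simp [verticalLift, tangentTS, hX]

theorem connectionMap_horizontalLift (hp : p ∈ TS n) :
    connectionMap p (horizontalLift p X) = 0 := by
  have h1 := hp.1
  simp only [connectionMap, horizontalLift, inner_smul_right, h1]
  simp

theorem connectionMap_verticalLift (hX : inner ℝ p.1 X = 0) :
    connectionMap p (verticalLift X) = X := by
  simp [connectionMap, verticalLift, hX]

theorem inner_connectionMap (hp : p ∈ TS n) : inner ℝ p.1 (connectionMap p w) = 0 := by
  have h1 := hp.1
  simp only [connectionMap, inner_sub_right, inner_smul_right, h1]
  ring

/-- The splitting of the tangent space into horizontal and vertical vectors. -/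
theorem horizontal_add_vertical (hw : w ∈ tangentTS p) :
    horizontalLift p w.1 + verticalLift (connectionMap p w) = w := by
  have h := hw.2
  rw [real_inner_comm] at h
  have h' : inner ℝ p.1 w.2 = -inner ℝ p.2 w.1 := by linarith
  refine Prod.ext ?_ ?_
  · simp [horizontalLift, verticalLift]
  · simp [horizontalLift, verticalLift, connectionMap, h']

theorem isotropicJ_horizontalLift (hp : p ∈ TS n) :
    isotropicJ α δ σ p (horizontalLift p X) =
      α p • verticalLift X + σ p • horizontalLift p X := by
  rw [isotropicJ, connectionMap_horizontalLift hp]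
  simp [horizontalLift, verticalLift]

theorem isotropicJ_verticalLift (hX : inner ℝ p.1 X = 0) :
    isotropicJ α δ σ p (verticalLift X) =
      -(σ p) • verticalLift X - δ p • horizontalLift p X := by
  rw [isotropicJ, connectionMap_verticalLift hX]
  simp [horizontalLift, verticalLift]

end Facts

/-- The (almost complex) structure `J` on the open subset `A` of `TS^n` is a complex structure:
around each point of `A` there are holomorphic coordinates, that is, a diffeomorphism `φ` from a
neighbourhood `U` onto an open subset `V` of `ℂ^n`, with inverse `ψ`, whose differential
intertwines `J` with multiplication by `i`. -/
def HasHolomorphicCharts {n : ℕ}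
    (J : RSpace n × RSpace n → RSpace n × RSpace n → RSpace n × RSpace n)
    (A : Set (RSpace n × RSpace n)) : Prop :=
  ∀ p ∈ A, ∃ (U : Set (RSpace n × RSpace n)) (V : Set (EuclideanSpace ℂ (Fin n)))
    (φ : RSpace n × RSpace n → EuclideanSpace ℂ (Fin n))
    (ψ : EuclideanSpace ℂ (Fin n) → RSpace n × RSpace n),
    IsOpenInTS U ∧ p ∈ U ∧ U ⊆ A ∧ IsOpen V ∧
    Set.MapsTo φ U V ∧ Set.MapsTo ψ V U ∧ Set.InvOn ψ φ U V ∧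
    ContDiffOn ℝ ∞ φ U ∧ ContDiffOn ℝ ∞ ψ V ∧
    ∀ x ∈ V, ∀ ζ : EuclideanSpace ℂ (Fin n),
      fderiv ℝ ψ x (Complex.I • ζ) = J (ψ x) (fderiv ℝ ψ x ζ)

/-- `X` is a smooth (real) vector field on the open subset `A` of `TS^n`. -/
def IsVectorField {n : ℕ} (A : Set (RSpace n × RSpace n))
    (X : RSpace n × RSpace n → RSpace n × RSpace n) : Prop :=
  ContDiffOn ℝ ∞ X A ∧ ∀ p ∈ A, X p ∈ tangentTS p

/-- The sections of `T^{(0,1)} = {X + i J X}` over `A` are closed under the Lie bracket. For two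
such sections `X + i J X` and `Y + i J Y`, the real part of the bracket is `[X, Y] - [JX, JY]` and
its imaginary part is `[X, JY] + [JX, Y]`, and the bracket is a section of `T^{(0,1)}` when the
second is `J` of the first.
(`lieBracketWithin ℝ X Y A p = DY_p (X p) - DX_p (Y p)` only involves derivatives along `A` in
directions tangent to `A`, hence is the Lie bracket on the submanifold.) -/
def IsInvolutive01 {n : ℕ}
    (J : RSpace n × RSpace n → RSpace n × RSpace n → RSpace n × RSpace n)
    (A : Set (RSpace n × RSpace n)) : Prop :=
  ∀ X Y : RSpace n × RSpace n → RSpace n × RSpace n, IsVectorField A X → IsVectorField A Y →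
    ∀ p ∈ A,
      VectorField.lieBracketWithin ℝ X (fun q => J q (Y q)) A p +
          VectorField.lieBracketWithin ℝ (fun q => J q (X q)) Y A p =
        J p (VectorField.lieBracketWithin ℝ X Y A p -
          VectorField.lieBracketWithin ℝ (fun q => J q (X q)) (fun q => J q (Y q)) A p)

/-- The open set `ℂ^{n+1} \ ℝ^{n+1}`. -/
def complexMinusReal (n : ℕ) : Set (CSpace n) := {w | ∃ i, (w i).im ≠ 0}

/-- `S` is a holomorphic hypersurface in the open set `Ω`: a (locally closed, embedded) complex
submanifold of complex codimension one, i.e. locally the zero set of a holomorphic function with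
nowhere vanishing differential. -/
def IsHolomorphicHypersurface {n : ℕ} (S Ω : Set (CSpace n)) : Prop :=
  S ⊆ Ω ∧ ∀ w ∈ S, ∃ (W : Set (CSpace n)) (h : CSpace n → ℂ),
    IsOpen W ∧ w ∈ W ∧ W ⊆ Ω ∧ DifferentiableOn ℂ h W ∧
    (∀ x ∈ W, fderiv ℂ h x ≠ 0) ∧ S ∩ W = {x ∈ W | h x = 0}

/-- The map `Φ((u, v), z) = v - z u`. -/
noncomputable def Phi {n : ℕ} (p : RSpace n × RSpace n) (z : ℂ) : CSpace n :=
  WithLp.toLp 2 fun i => ((p.2 i : ℝ) : ℂ) - z * ((p.1 i : ℝ) : ℂ)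

/-- The function `z = (σ + i) / δ`. -/
noncomputable def zFun {n : ℕ} (δ σ : RSpace n × RSpace n → ℝ) (p : RSpace n × RSpace n) : ℂ :=
  ((σ p : ℂ) + Complex.I) / (δ p : ℂ)

end IsotropicSphere

/-!
Write `F (u, v) = v - z(u, v) u`. The map `(u, v, z) ↦ v - z u` is a diffeomorphism from
`TS^n × H_+` onto `ℂ^{n+1} \ ℝ^{n+1}`, so `F` embeds `A` with real codimension two. Both notions of
integrability, and the property of `F '' A` of being a holomorphic hypersurface, are shown to be
equivalent to complex linearity of the differential on the tangent spaces of `A`, that is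
`dF ∘ J = i dF` (`GraphMapHolomorphic`).

The basic computation is that `dF (J w) - i dF w` always is a multiple `defect w • u` of `u`
(`fderiv_graphMap_isotropicJ`), and that it vanishes as soon as it does for vertical `w`
(`graphMapHolomorphic_of_vertical`).

* If `F '' A` is a holomorphic hypersurface with local equation `h = 0`, then `ker dh` contains the
  vectors `dF (X^v) = X - dz(X^v) u`. Hence it does not contain `u`, for otherwise `dh = 0`. But it
  contains `dF (J X^v) - i dF (X^v) ∈ ℂ u`, which therefore is zero.
* If the sections of `T^{(0,1)}` are closed under the bracket, derive `F` along the bracket of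
  `X^v + i J X^v` and `Y^v + i J Y^v` (`fderiv_nijenhuis`). As `J X^v` projects to `-δ X` on the
  sphere, this gives `defect (Y^v) X - defect (X^v) Y ∈ ℂ u`. Since `n ≥ 2`, one may take `Y`
  nonzero and orthogonal to `X`, and `defect (X^v) = 0` follows.
* If `dF ∘ J = i dF`, choose linear coordinates `e = (e₁, e₂)` of `ℂ^{n+1}` with `e u₀ = (0, 1)` at
  a given point `(u₀, v₀)`. The function `z(u, v) - z` of `w = v - z u` vanishes exactly on `F '' A`,
  and its derivative along `ℂ u₀` is the identity. By the inverse function theorem `F '' A` is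
  locally the graph of a function of `e₁`, and `e₁ ∘ F` is a chart of `A`. Complex linearity of
  `dF` makes the chart intertwine `J` and `i`, and makes the function holomorphic.
* Holomorphic charts `φ` make `T^{(0,1)}` involutive: this is `fderiv_nijenhuis` for `φ`.

Functions on `A` are differentiated by extending them to the ambient space with the help of a
smooth retraction onto `TS^n`; the derivatives along tangent vectors do not depend on the extension
(`fderiv_apply_congr`).
-/

namespace IsotropicSphere

open Filter
open scoped Topology

/-! ### The complexification of real vectors -/

/-- The inclusion `ℝ^{n+1} ⊆ ℂ^{n+1}`, as a real linear map. -/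
noncomputable def complexify (n : ℕ) : RSpace n →L[ℝ] CSpace n :=
  LinearMap.toContinuousLinearMap
    { toFun := fun x => WithLp.toLp 2 fun i => ((x i : ℝ) : ℂ)
      map_add' := fun x y => by ext i; simp
      map_smul' := fun c x => by ext i; simp }

/-- The real part of a complex vector. -/
noncomputable def rePart (n : ℕ) : CSpace n →L[ℝ] RSpace n :=
  LinearMap.toContinuousLinearMap
    { toFun := fun w => WithLp.toLp 2 fun i => (w i).re
      map_add' := fun x y => by ext i; simp
      map_smul' := fun c x => by ext i; simp }

/-- The imaginary part of a complex vector. -/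
noncomputable def imPart (n : ℕ) : CSpace n →L[ℝ] RSpace n :=
  LinearMap.toContinuousLinearMap
    { toFun := fun w => WithLp.toLp 2 fun i => (w i).im
      map_add' := fun x y => by ext i; simp
      map_smul' := fun c x => by ext i; simp }

variable {n : ℕ}

@[simp] theorem complexify_apply (x : RSpace n) (i : Fin (n + 1)) :
    complexify n x i = ((x i : ℝ) : ℂ) := rfl

@[simp] theorem rePart_apply (w : CSpace n) (i : Fin (n + 1)) : rePart n w i = (w i).re := rfl

@[simp] theorem imPart_apply (w : CSpace n) (i : Fin (n + 1)) : imPart n w i = (w i).im := rfl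

theorem Phi_eq (p : RSpace n × RSpace n) (z : ℂ) :
    Phi p z = complexify n p.2 - z • complexify n p.1 := by
  ext i; simp [Phi]

theorem complexify_re_add_im (w : CSpace n) :
    complexify n (rePart n w) + Complex.I • complexify n (imPart n w) = w := by
  ext i
  simp [mul_comm Complex.I]

theorem complexify_smul (c : ℝ) (x : RSpace n) :
    complexify n (c • x) = (c : ℂ) • complexify n x := by
  ext i; simp

theorem rePart_smul_complexify (c : ℂ) (x : RSpace n) :
    rePart n (c • complexify n x) = c.re • x := by
  ext i; simp

theorem imPart_smul_complexify (c : ℂ) (x : RSpace n) :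
    imPart n (c • complexify n x) = c.im • x := by
  ext i; simp

theorem rePart_complexify (x : RSpace n) : rePart n (complexify n x) = x := by
  ext i; simp

theorem imPart_complexify (x : RSpace n) : imPart n (complexify n x) = 0 := by
  ext i; simp

theorem mem_complexMinusReal_iff (w : CSpace n) :
    w ∈ complexMinusReal n ↔ imPart n w ≠ 0 := by
  constructor
  · rintro ⟨i, hi⟩ h
    exact hi (by rw [← imPart_apply, h]; rfl)
  · intro h
    by_contra hc
    apply h
    ext i
    by_contra hi
    exact hc ⟨i, hi⟩

/-! ### The tangent bundle as a smooth retract of an open set -/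

/-- The defining functions `(u ⬝ u, u ⬝ v)` of `TS^n`. -/
noncomputable def constraint (q : RSpace n × RSpace n) : ℝ × ℝ :=
  (inner ℝ q.1 q.1, inner ℝ q.1 q.2)

theorem contDiff_constraint : ContDiff ℝ ∞ (constraint (n := n)) := by
  unfold constraint
  exact (contDiff_fst.inner ℝ contDiff_fst).prodMk (contDiff_fst.inner ℝ contDiff_snd)

theorem fderiv_constraint (p w : RSpace n × RSpace n) :
    fderiv ℝ constraint p w =
      (2 * inner ℝ p.1 w.1, inner ℝ w.1 p.2 + inner ℝ p.1 w.2) := by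
  have h1 : HasFDerivAt (Prod.fst : RSpace n × RSpace n → RSpace n) _ p := hasFDerivAt_fst (𝕜 := ℝ)
  have h2 : HasFDerivAt (Prod.snd : RSpace n × RSpace n → RSpace n) _ p := hasFDerivAt_snd (𝕜 := ℝ)
  have h := (h1.inner ℝ h1).prodMk (h1.inner ℝ h2)
  have h' : fderiv ℝ constraint p = _ := HasFDerivAt.fderiv h
  rw [h']
  simp [fderivInnerCLM_apply, real_inner_comm, add_comm, two_mul]

theorem mem_tangentTS_iff (p w : RSpace n × RSpace n) :
    w ∈ tangentTS p ↔ fderiv ℝ constraint p w = 0 := by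
  simp [fderiv_constraint, tangentTS]

theorem constraint_eq_of_mem {p : RSpace n × RSpace n} (hp : p ∈ TS n) :
    constraint p = (1, 0) := Prod.ext hp.1 hp.2

theorem smul_mem_tangentTS {p w : RSpace n × RSpace n} (c : ℝ) (hw : w ∈ tangentTS p) :
    c • w ∈ tangentTS p := by
  rw [mem_tangentTS_iff] at *
  rw [map_smul, hw, smul_zero]

theorem add_mem_tangentTS {p w w' : RSpace n × RSpace n} (hw : w ∈ tangentTS p)
    (hw' : w' ∈ tangentTS p) : w + w' ∈ tangentTS p := by
  rw [mem_tangentTS_iff] at *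
  rw [map_add, hw, hw', add_zero]

theorem sub_mem_tangentTS {p w w' : RSpace n × RSpace n} (hw : w ∈ tangentTS p)
    (hw' : w' ∈ tangentTS p) : w - w' ∈ tangentTS p := by
  rw [mem_tangentTS_iff] at *
  rw [map_sub, hw, hw', sub_zero]

/-- The smooth retraction `(u, v) ↦ (u / |u|, v - (u ⬝ v) / (u ⬝ u) u)` of `{u ≠ 0}` onto `TS^n`.
Composing with it extends functions on subsets of `TS^n` to the ambient space. -/
noncomputable def retraction (q : RSpace n × RSpace n) : RSpace n × RSpace n :=
  ((√(inner ℝ q.1 q.1))⁻¹ • q.1, q.2 - (inner ℝ q.1 q.2 * (inner ℝ q.1 q.1)⁻¹) • q.1)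

theorem fst_ne_zero {p : RSpace n × RSpace n} (hp : p ∈ TS n) : p.1 ≠ 0 := by
  intro h
  have := hp.1
  simp [h] at this

theorem retraction_of_mem {p : RSpace n × RSpace n} (hp : p ∈ TS n) : retraction p = p := by
  have h1 := hp.1
  have h2 := hp.2
  rw [retraction, h1, h2]
  simp

theorem retraction_mem {q : RSpace n × RSpace n} (hq : q.1 ≠ 0) : retraction q ∈ TS n := by
  have h0 : (0 : ℝ) < inner ℝ q.1 q.1 := real_inner_self_pos.2 hq
  have hs : √(inner ℝ q.1 q.1 : ℝ) ≠ 0 := (Real.sqrt_pos.2 h0).ne'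
  refine ⟨?_, ?_⟩
  · simp only [retraction, inner_smul_left, inner_smul_right, conj_trivial]
    field_simp
    exact (Real.sq_sqrt h0.le).symm
  · simp only [retraction, inner_smul_left, inner_smul_right, inner_sub_right, conj_trivial]
    field_simp
    simp

theorem contDiffAt_retraction {q : RSpace n × RSpace n} (hq : q.1 ≠ 0) :
    ContDiffAt ℝ ∞ retraction q := by
  have h0 : (inner ℝ q.1 q.1 : ℝ) ≠ 0 := (real_inner_self_pos.2 hq).ne'
  have h1 : ContDiffAt ℝ ∞ (Prod.fst : RSpace n × RSpace n → RSpace n) q := contDiffAt_fst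
  have h2 : ContDiffAt ℝ ∞ (Prod.snd : RSpace n × RSpace n → RSpace n) q := contDiffAt_snd
  have h11 := h1.inner ℝ h1
  have hs : √(inner ℝ q.1 q.1 : ℝ) ≠ 0 := (Real.sqrt_pos.2 (real_inner_self_pos.2 hq)).ne'
  exact (((h11.sqrt h0).inv hs).smul h1).prodMk
    (h2.sub (((h1.inner ℝ h2).mul (h11.inv h0)).smul h1))

theorem fderiv_retraction {p w : RSpace n × RSpace n} (hp : p ∈ TS n) (hw : w ∈ tangentTS p) :
    fderiv ℝ retraction p w = w := by
  have e1 := hp.1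
  have e2 := hp.2
  have t1 := hw.1
  have t2 := hw.2
  have h1 : HasFDerivAt (Prod.fst : RSpace n × RSpace n → RSpace n) _ p := hasFDerivAt_fst (𝕜 := ℝ)
  have h2 : HasFDerivAt (Prod.snd : RSpace n × RSpace n → RSpace n) _ p := hasFDerivAt_snd (𝕜 := ℝ)
  have h11 := h1.inner ℝ h1
  have h0 : (inner ℝ p.1 p.1 : ℝ) ≠ 0 := by rw [e1]; exact one_ne_zero
  have hs : √(inner ℝ p.1 p.1 : ℝ) ≠ 0 := by rw [e1]; simp
  have h := (((hasDerivAt_inv hs).comp_hasFDerivAt p (h11.sqrt h0)).smul h1).prodMk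
    (h2.sub (((h1.inner ℝ h2).mul ((hasDerivAt_inv h0).comp_hasFDerivAt p h11)).smul h1))
  have h' : fderiv ℝ retraction p = _ := HasFDerivAt.fderiv h
  rw [h']
  have t1' : inner ℝ w.1 p.1 = 0 := by rw [real_inner_comm]; exact t1
  have t2' : inner ℝ p.1 w.2 + inner ℝ w.1 p.2 = 0 := by linarith
  ext1
  · simp [fderivInnerCLM_apply, e1, t1, t1', -inner_self_eq_norm_sq_to_K]
  · simp [fderivInnerCLM_apply, e1, e2, t1, t1', t2', -inner_self_eq_norm_sq_to_K]

theorem IsOpenInTS.subset {A : Set (RSpace n × RSpace n)} (hA : IsOpenInTS A) : A ⊆ TS n := by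
  obtain ⟨O, -, rfl⟩ := hA
  exact Set.inter_subset_right

theorem IsOpenInTS.mem_nhdsWithin {A : Set (RSpace n × RSpace n)} (hA : IsOpenInTS A)
    {p : RSpace n × RSpace n} (hp : p ∈ A) : A ∈ 𝓝[TS n] p := by
  obtain ⟨O, hO, rfl⟩ := hA
  rw [Set.inter_comm]
  exact inter_mem_nhdsWithin _ (hO.mem_nhds hp.1)

theorem tendsto_retraction {p : RSpace n × RSpace n} (hp : p ∈ TS n) :
    Tendsto retraction (𝓝 p) (𝓝[TS n] p) := by
  refine tendsto_nhdsWithin_iff.2 ⟨?_, ?_⟩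
  · have := (contDiffAt_retraction (fst_ne_zero hp)).continuousAt.tendsto
    rwa [retraction_of_mem hp] at this
  · have : ∀ᶠ q : RSpace n × RSpace n in 𝓝 p, q.1 ≠ 0 :=
      continuousAt_fst.eventually_ne (fst_ne_zero hp)
    exact this.mono fun q hq => retraction_mem hq

variable {E : Type*} [NormedAddCommGroup E] [NormedSpace ℝ E]

/-- A smooth function on an open subset of `TS^n` extends smoothly to the ambient space. -/
theorem contDiffAt_comp_retraction {A : Set (RSpace n × RSpace n)} (hA : IsOpenInTS A)
    {f : RSpace n × RSpace n → E} (hf : ContDiffOn ℝ ∞ f A) {p : RSpace n × RSpace n}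
    (hp : p ∈ A) : ContDiffAt ℝ ∞ (f ∘ retraction) p := by
  have hT := hA.subset hp
  have hr := contDiffAt_retraction (fst_ne_zero hT)
  have hf' : ContDiffWithinAt ℝ ∞ f A (retraction p) := by
    rw [retraction_of_mem hT]; exact hf p hp
  have hm : ∀ᶠ q in 𝓝 p, retraction q ∈ A := tendsto_retraction hT (hA.mem_nhdsWithin hp)
  rw [← contDiffWithinAt_univ] at hr ⊢
  refine (hf'.comp_of_preimage_mem_nhdsWithin p hr ?_)
  rw [nhdsWithin_univ]
  exact hm

/-- The derivative at `p ∈ TS^n` in tangent directions only depends on the values on `TS^n`. -/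
theorem fderiv_apply_congr {g₁ g₂ : RSpace n × RSpace n → E} {p w : RSpace n × RSpace n}
    (hp : p ∈ TS n) (h₁ : DifferentiableAt ℝ g₁ p) (h₂ : DifferentiableAt ℝ g₂ p)
    (h : ∀ᶠ q in 𝓝[TS n] p, g₁ q = g₂ q) (hw : w ∈ tangentTS p) :
    fderiv ℝ g₁ p w = fderiv ℝ g₂ p w := by
  have key : ∀ g : RSpace n × RSpace n → E, DifferentiableAt ℝ g p →
      fderiv ℝ (g ∘ retraction) p w = fderiv ℝ g p w := by
    intro g hg
    have hr := (contDiffAt_retraction (fst_ne_zero hp)).differentiableAt (by simp)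
    rw [fderiv_comp p (by rwa [retraction_of_mem hp]) hr, retraction_of_mem hp]
    simp [fderiv_retraction hp hw]
  rw [← key g₁ h₁, ← key g₂ h₂]
  have : g₁ ∘ retraction =ᶠ[𝓝 p] g₂ ∘ retraction := (tendsto_retraction hp).eventually h
  rw [this.fderiv_eq]

theorem fderivWithin_apply_eq {A : Set (RSpace n × RSpace n)} (hA : IsOpenInTS A)
    {f : RSpace n × RSpace n → E} {p w : RSpace n × RSpace n} (hp : p ∈ A)
    (hf : DifferentiableWithinAt ℝ f A p) (hw : w ∈ tangentTS p) :
    fderivWithin ℝ f A p w = fderiv ℝ (f ∘ retraction) p w := by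
  have hT := hA.subset hp
  have hr := ((contDiffAt_retraction (fst_ne_zero hT)).differentiableAt (by simp)).hasFDerivAt
  have hf' : HasFDerivWithinAt f (fderivWithin ℝ f A p) A (retraction p) := by
    rw [retraction_of_mem hT]; exact hf.hasFDerivWithinAt
  have hm : ∀ᶠ q in 𝓝 p, retraction q ∈ A := tendsto_retraction hT (hA.mem_nhdsWithin hp)
  have := hf'.comp_hasFDerivAt p hr hm
  rw [this.fderiv]
  simp [fderiv_retraction hT hw]

variable {A : Set (RSpace n × RSpace n)} {α δ σ : RSpace n × RSpace n → ℝ}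

/-! ### Lie brackets on the tangent bundle -/

theorem IsVectorField.differentiableAt_comp_retraction (hA : IsOpenInTS A)
    {X : RSpace n × RSpace n → RSpace n × RSpace n} (hX : IsVectorField A X)
    {p : RSpace n × RSpace n} (hp : p ∈ A) : DifferentiableAt ℝ (X ∘ retraction) p :=
  (contDiffAt_comp_retraction hA hX.1 hp).differentiableAt (by simp)

theorem lieBracketWithin_eq (hA : IsOpenInTS A)
    {X Y : RSpace n × RSpace n → RSpace n × RSpace n} (hX : IsVectorField A X)
    (hY : IsVectorField A Y) {p : RSpace n × RSpace n} (hp : p ∈ A) :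
    VectorField.lieBracketWithin ℝ X Y A p =
      VectorField.lieBracket ℝ (X ∘ retraction) (Y ∘ retraction) p := by
  have hX' := (hX.1 p hp).differentiableWithinAt (by simp)
  have hY' := (hY.1 p hp).differentiableWithinAt (by simp)
  rw [VectorField.lieBracketWithin, VectorField.lieBracket,
    fderivWithin_apply_eq hA hp hX' (hY.2 p hp), fderivWithin_apply_eq hA hp hY' (hX.2 p hp)]
  simp [retraction_of_mem (hA.subset hp)]

/-- The bracket acts on functions as the commutator of derivations. -/
theorem fderiv_lieBracketWithin (hA : IsOpenInTS A)
    {X Y : RSpace n × RSpace n → RSpace n × RSpace n} (hX : IsVectorField A X)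
    (hY : IsVectorField A Y) {p : RSpace n × RSpace n} (hp : p ∈ A)
    {f : RSpace n × RSpace n → E} (hf : ContDiffAt ℝ ∞ f p) :
    fderiv ℝ f p (VectorField.lieBracketWithin ℝ X Y A p) =
      fderiv ℝ (fun q => fderiv ℝ f q (Y (retraction q))) p (X p) -
        fderiv ℝ (fun q => fderiv ℝ f q (X (retraction q))) p (Y p) := by
  rw [lieBracketWithin_eq hA hX hY hp, VectorField.fderiv_apply_lieBracket_of_isSymmSndFDerivAt
    (hf.of_le ENat.LEInfty.out)
    (hf.isSymmSndFDerivAt (by simp [minSmoothness_of_isRCLikeNormedField, ENat.LEInfty.out]))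
    (hY.differentiableAt_comp_retraction hA hp) (hX.differentiableAt_comp_retraction hA hp)]
  simp [retraction_of_mem (hA.subset hp)]

theorem differentiableAt_fderiv_apply (hA : IsOpenInTS A)
    {X : RSpace n × RSpace n → RSpace n × RSpace n} (hX : IsVectorField A X)
    {p : RSpace n × RSpace n} (hp : p ∈ A)
    {f : RSpace n × RSpace n → E} (hf : ContDiffAt ℝ ∞ f p) :
    DifferentiableAt ℝ (fun q => fderiv ℝ f q (X (retraction q))) p := by
  have h1 : DifferentiableAt ℝ (fderiv ℝ f) p :=
    (hf.fderiv_right (m := 1) (by rw [one_add_one_eq_two]; exact ENat.LEInfty.out)).differentiableAt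
      (by simp)
  exact h1.clm_apply (hX.differentiableAt_comp_retraction hA hp)

theorem eventually_nhdsWithin_TS (hA : IsOpenInTS A) {p : RSpace n × RSpace n} (hp : p ∈ A)
    {P : RSpace n × RSpace n → Prop} (h : ∀ q ∈ A, P q) : ∀ᶠ q in 𝓝[TS n] p, P q :=
  by
  filter_upwards [hA.mem_nhdsWithin hp] using h

theorem lieBracketWithin_mem_tangentTS (hA : IsOpenInTS A)
    {X Y : RSpace n × RSpace n → RSpace n × RSpace n} (hX : IsVectorField A X)
    (hY : IsVectorField A Y) {p : RSpace n × RSpace n} (hp : p ∈ A) :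
    VectorField.lieBracketWithin ℝ X Y A p ∈ tangentTS p := by
  have hc : ContDiffAt ℝ ∞ (constraint (n := n)) p := contDiff_constraint.contDiffAt
  rw [mem_tangentTS_iff, fderiv_lieBracketWithin hA hX hY hp hc]
  have key : ∀ Z W : RSpace n × RSpace n → RSpace n × RSpace n, IsVectorField A Z →
      IsVectorField A W →
      fderiv ℝ (fun q => fderiv ℝ constraint q (Z (retraction q))) p (W p) = 0 := by
    intro Z W hZ hW
    rw [fderiv_apply_congr (g₂ := fun _ => (0 : ℝ × ℝ)) (hA.subset hp)
      (differentiableAt_fderiv_apply hA hZ hp hc) (by fun_prop) _ (hW.2 p hp)]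
    · simp
    · refine eventually_nhdsWithin_TS hA hp fun q hq => ?_
      rw [retraction_of_mem (hA.subset hq)]
      exact (mem_tangentTS_iff _ _).1 (hZ.2 q hq)
  rw [key Y X hY hX, key X Y hX hY, sub_zero]

/-- The Nijenhuis expression of two pairs `(X, X')`, `(Y, Y')` of vector fields, where `X'` and `Y'`
play the parts of `J X` and `J Y`, as seen through a map `f` to a complex vector space for which
`df X' = i df X + e` and `df Y' = i df Y + e'`. -/
theorem fderiv_nijenhuis [NormedSpace ℂ E] [IsScalarTower ℝ ℂ E] (hA : IsOpenInTS A)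
    {X Y X' Y' : RSpace n × RSpace n → RSpace n × RSpace n} (hX : IsVectorField A X)
    (hY : IsVectorField A Y) (hX' : IsVectorField A X') (hY' : IsVectorField A Y')
    {p : RSpace n × RSpace n} (hp : p ∈ A)
    {f e e' : RSpace n × RSpace n → E} (hf : ContDiffAt ℝ ∞ f p)
    (he : DifferentiableAt ℝ e p) (he' : DifferentiableAt ℝ e' p)
    (hfX : ∀ᶠ q in 𝓝[TS n] p, fderiv ℝ f q (X' q) = Complex.I • fderiv ℝ f q (X q) + e q)
    (hfY : ∀ᶠ q in 𝓝[TS n] p, fderiv ℝ f q (Y' q) = Complex.I • fderiv ℝ f q (Y q) + e' q) :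
    fderiv ℝ f p (VectorField.lieBracketWithin ℝ X Y' A p +
        VectorField.lieBracketWithin ℝ X' Y A p) =
      Complex.I • fderiv ℝ f p (VectorField.lieBracketWithin ℝ X Y A p -
        VectorField.lieBracketWithin ℝ X' Y' A p) +
      (fderiv ℝ e' p (X p) - fderiv ℝ e p (Y p) +
        Complex.I • (fderiv ℝ e' p (X' p) - fderiv ℝ e p (Y' p))) := by
  have key : ∀ Z Z' e : RSpace n × RSpace n → _, IsVectorField A Z → IsVectorField A Z' →
      DifferentiableAt ℝ e p →
      (∀ᶠ q in 𝓝[TS n] p, fderiv ℝ f q (Z' q) = Complex.I • fderiv ℝ f q (Z q) + e q) →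
      ∀ w ∈ tangentTS p, fderiv ℝ (fun q => fderiv ℝ f q (Z' (retraction q))) p w =
        Complex.I • fderiv ℝ (fun q => fderiv ℝ f q (Z (retraction q))) p w + fderiv ℝ e p w := by
    intro Z Z' e hZ hZ' he h w hw
    have hd := differentiableAt_fderiv_apply hA hZ hp hf
    rw [fderiv_apply_congr (hA.subset hp) (differentiableAt_fderiv_apply hA hZ' hp hf)
      ((hd.const_smul Complex.I).add he) _ hw]
    · rw [fderiv_add (hd.const_smul Complex.I) he, fderiv_const_smul hd]
      rfl
    · filter_upwards [h, self_mem_nhdsWithin] with q hq hqT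
      simpa [retraction_of_mem hqT] using hq
  have kX := key X X' e hX hX' he hfX
  have kY := key Y Y' e' hY hY' he' hfY
  rw [map_add, map_sub, fderiv_lieBracketWithin hA hX hY' hp hf,
    fderiv_lieBracketWithin hA hX' hY hp hf, fderiv_lieBracketWithin hA hX hY hp hf,
    fderiv_lieBracketWithin hA hX' hY' hp hf, kY _ (hX.2 p hp), kX _ (hY.2 p hp),
    kY _ (hX'.2 p hp), kX _ (hY'.2 p hp)]
  simp only [smul_sub, smul_add, smul_smul, Complex.I_mul_I, neg_smul, one_smul]
  abel

/-! ### The isotropic almost complex structure -/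

theorem isotropicJ_mem {p w : RSpace n × RSpace n} (hp : p ∈ TS n) (hw : w ∈ tangentTS p) :
    isotropicJ α δ σ p w ∈ tangentTS p := by
  have hK := inner_connectionMap (w := w) hp
  exact add_mem_tangentTS (add_mem_tangentTS (smul_mem_tangentTS _ (verticalLift_mem hw.1))
      (smul_mem_tangentTS _ (horizontalLift_mem hp hw.1)))
    (sub_mem_tangentTS (smul_mem_tangentTS _ (verticalLift_mem hK))
      (smul_mem_tangentTS _ (horizontalLift_mem hp hK)))

theorem IsVectorField.isotropicJ (hA : IsOpenInTS A) (hα : ContDiffOn ℝ ∞ α A)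
    (hδ : ContDiffOn ℝ ∞ δ A) (hσ : ContDiffOn ℝ ∞ σ A)
    {X : RSpace n × RSpace n → RSpace n × RSpace n} (hX : IsVectorField A X) :
    IsVectorField A fun q => isotropicJ α δ σ q (X q) := by
  refine ⟨?_, fun p hp => isotropicJ_mem (hA.subset hp) (hX.2 p hp)⟩
  have hf : ContDiffOn ℝ ∞ (Prod.fst : RSpace n × RSpace n → RSpace n) A := contDiffOn_fst
  have hs : ContDiffOn ℝ ∞ (Prod.snd : RSpace n × RSpace n → RSpace n) A := contDiffOn_snd
  have hX1 : ContDiffOn ℝ ∞ (fun q => (X q).1) A := contDiff_fst.comp_contDiffOn hX.1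
  have hX2 : ContDiffOn ℝ ∞ (fun q => (X q).2) A := contDiff_snd.comp_contDiffOn hX.1
  have hv : ∀ Z : RSpace n × RSpace n → RSpace n, ContDiffOn ℝ ∞ Z A →
      ContDiffOn ℝ ∞ (fun q => verticalLift (Z q)) A :=
    fun Z hZ => contDiffOn_const.prodMk hZ
  have hh : ∀ Z : RSpace n × RSpace n → RSpace n, ContDiffOn ℝ ∞ Z A →
      ContDiffOn ℝ ∞ (fun q => horizontalLift q (Z q)) A :=
    fun Z hZ => hZ.prodMk ((hs.inner ℝ hZ).neg.smul hf)
  have hK : ContDiffOn ℝ ∞ (fun q => connectionMap q (X q)) A :=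
    hX2.sub ((hf.inner ℝ hX2).smul hf)
  exact ((hα.smul (hv _ hX1)).add (hσ.smul (hh _ hX1))).add
    ((hσ.neg.smul (hv _ hK)).sub (hδ.smul (hh _ hK)))

theorem contDiffOn_zFun (hδ : ContDiffOn ℝ ∞ δ A) (hσ : ContDiffOn ℝ ∞ σ A)
    (hδ_pos : ∀ p ∈ A, 0 < δ p) : ContDiffOn ℝ ∞ (zFun δ σ) A := by
  have hδ' : ContDiffOn ℝ ∞ (fun p => (δ p : ℂ)) A := Complex.ofRealCLM.contDiff.comp_contDiffOn hδ
  have hσ' : ContDiffOn ℝ ∞ (fun p => (σ p : ℂ)) A := Complex.ofRealCLM.contDiff.comp_contDiffOn hσ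
  have : ContDiffOn ℝ ∞ (fun p => (δ p : ℂ)⁻¹) A :=
    hδ'.inv fun p hp => by exact_mod_cast (hδ_pos p hp).ne'
  exact (hσ'.add contDiffOn_const).mul this

theorem zFun_im (p : RSpace n × RSpace n) : (zFun δ σ p).im = (δ p)⁻¹ := by
  rw [zFun, Complex.div_ofReal_im]
  simp

/-! ### The hypersurface and its tangent spaces -/

/-- The map `(u, v) ↦ v - z(u, v) u`, extended smoothly to a neighbourhood of `A` in the ambient
space. -/
noncomputable def graphMap (δ σ : RSpace n × RSpace n → ℝ) (q : RSpace n × RSpace n) : CSpace n :=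
  complexify n q.2 - zFun δ σ (retraction q) • complexify n q.1

theorem graphMap_of_mem {q : RSpace n × RSpace n} (hq : q ∈ TS n) :
    graphMap δ σ q = Phi q (zFun δ σ q) := by
  rw [graphMap, retraction_of_mem hq, Phi_eq]

theorem contDiffAt_zFun_comp_retraction (hA : IsOpenInTS A) (hδ : ContDiffOn ℝ ∞ δ A)
    (hσ : ContDiffOn ℝ ∞ σ A) (hδ_pos : ∀ p ∈ A, 0 < δ p) {p : RSpace n × RSpace n} (hp : p ∈ A) :
    ContDiffAt ℝ ∞ (zFun δ σ ∘ retraction) p :=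
  contDiffAt_comp_retraction hA (contDiffOn_zFun hδ hσ hδ_pos) hp

theorem contDiffAt_graphMap (hA : IsOpenInTS A) (hδ : ContDiffOn ℝ ∞ δ A)
    (hσ : ContDiffOn ℝ ∞ σ A) (hδ_pos : ∀ p ∈ A, 0 < δ p) {p : RSpace n × RSpace n} (hp : p ∈ A) :
    ContDiffAt ℝ ∞ (graphMap δ σ) p := by
  have hz := contDiffAt_zFun_comp_retraction hA hδ hσ hδ_pos hp
  have h1 : ContDiffAt ℝ ∞ (fun q : RSpace n × RSpace n => complexify n q.1) p := by fun_prop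
  have h2 : ContDiffAt ℝ ∞ (fun q : RSpace n × RSpace n => complexify n q.2) p := by fun_prop
  exact h2.sub (hz.smul h1)

theorem fderiv_graphMap (hA : IsOpenInTS A) (hδ : ContDiffOn ℝ ∞ δ A)
    (hσ : ContDiffOn ℝ ∞ σ A) (hδ_pos : ∀ p ∈ A, 0 < δ p) {p : RSpace n × RSpace n} (hp : p ∈ A)
    (w : RSpace n × RSpace n) :
    fderiv ℝ (graphMap δ σ) p w = complexify n w.2 - zFun δ σ p • complexify n w.1 -
      fderiv ℝ (zFun δ σ ∘ retraction) p w • complexify n p.1 := by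
  have hz := ((contDiffAt_zFun_comp_retraction hA hδ hσ hδ_pos hp).differentiableAt
    (by simp)).hasFDerivAt
  have h1 : HasFDerivAt (fun q : RSpace n × RSpace n => complexify n q.1)
    ((complexify n).comp (ContinuousLinearMap.fst ℝ _ _)) p :=
      (complexify n).hasFDerivAt.comp p hasFDerivAt_fst
  have h2 : HasFDerivAt (fun q : RSpace n × RSpace n => complexify n q.2)
    ((complexify n).comp (ContinuousLinearMap.snd ℝ _ _)) p :=
      (complexify n).hasFDerivAt.comp p hasFDerivAt_snd
  have h' : fderiv ℝ (graphMap δ σ) p = _ := (h2.sub (hz.smul h1)).fderiv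
  rw [h']
  simp [retraction_of_mem (hA.subset hp)]
  abel

/-- The coefficient `c` in `dF (J w) = i dF w + c u`, where `F (u, v) = v - z(u, v) u`. -/
noncomputable def defect (α δ σ : RSpace n × RSpace n → ℝ) (p w : RSpace n × RSpace n) : ℂ :=
  -Complex.I * (inner ℝ p.1 w.2 : ℝ) + δ p * (inner ℝ p.2 (connectionMap p w) : ℝ)
    - σ p * (inner ℝ p.2 w.1 : ℝ)
    - fderiv ℝ (zFun δ σ ∘ retraction) p (isotropicJ α δ σ p w)
    + Complex.I * fderiv ℝ (zFun δ σ ∘ retraction) p w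

/-- Modulo `ℂ u`, the differential of `(u, v) ↦ v - z(u, v) u` intertwines `J` and `i`. -/
theorem fderiv_graphMap_isotropicJ (hA : IsOpenInTS A) (hδ : ContDiffOn ℝ ∞ δ A)
    (hσ : ContDiffOn ℝ ∞ σ A) (hδ_pos : ∀ p ∈ A, 0 < δ p)
    (hαδσ : ∀ p ∈ A, α p * δ p - σ p ^ 2 = 1) {p : RSpace n × RSpace n} (hp : p ∈ A)
    (w : RSpace n × RSpace n) :
    fderiv ℝ (graphMap δ σ) p (isotropicJ α δ σ p w) =
      Complex.I • fderiv ℝ (graphMap δ σ) p w + defect α δ σ p w • complexify n p.1 := by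
  rw [fderiv_graphMap hA hδ hσ hδ_pos hp, fderiv_graphMap hA hδ hσ hδ_pos hp, defect]
  set d := fderiv ℝ (zFun δ σ ∘ retraction) p
  have h0 : (δ p : ℂ) ≠ 0 := by exact_mod_cast (hδ_pos p hp).ne'
  have h1 : (α p : ℂ) * δ p - σ p ^ 2 = 1 := by exact_mod_cast hαδσ p hp
  have hz : zFun δ σ p * δ p = σ p + Complex.I := by rw [zFun, div_mul_cancel₀ _ h0]
  -- `α = z (σ - i) = |z|² δ`, the form in which `α δ - σ² = 1` enters
  have ha : (α p : ℂ) = zFun δ σ p * (σ p - Complex.I) := by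
    apply mul_right_cancel₀ h0
    linear_combination h1 - (σ p - Complex.I) * hz + Complex.I_sq
  have e1 : (isotropicJ α δ σ p w).1 = σ p • w.1 - δ p • connectionMap p w := by
    simp [isotropicJ, verticalLift, horizontalLift, sub_eq_add_neg]
  have e2 : (isotropicJ α δ σ p w).2 = α p • w.1 - σ p • connectionMap p w +
      (δ p * inner ℝ p.2 (connectionMap p w) - σ p * inner ℝ p.2 w.1) • p.1 := by
    simp only [isotropicJ, verticalLift, horizontalLift, Prod.snd_add, Prod.snd_sub, Prod.smul_snd]
    module
  have e3 : w.2 = connectionMap p w + (inner ℝ p.1 w.2 : ℝ) • p.1 := by simp [connectionMap]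
  rw [e1, e2]
  generalize isotropicJ α δ σ p w = Jw at *
  have e4 : complexify n w.2 = complexify n (connectionMap p w) +
      ((inner ℝ p.1 w.2 : ℝ) : ℂ) • complexify n p.1 := by
    conv_lhs => rw [e3]
    rw [map_add, complexify_smul]
  rw [e4]
  simp only [map_sub, map_add, complexify_smul, ha]
  generalize complexify n (connectionMap p w) = K
  push_cast
  linear_combination (norm := module) hz • K

/-- The differential of `(u, v) ↦ v - z(u, v) u` is complex linear on the tangent spaces of `A`
with respect to the almost complex structure `J`. -/
def GraphMapHolomorphic (α δ σ : RSpace n × RSpace n → ℝ) (A : Set (RSpace n × RSpace n)) : Prop :=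
  ∀ p ∈ A, ∀ w ∈ tangentTS p, fderiv ℝ (graphMap δ σ) p (isotropicJ α δ σ p w) =
    Complex.I • fderiv ℝ (graphMap δ σ) p w

theorem complexify_eq_zero_iff {x : RSpace n} : complexify n x = 0 ↔ x = 0 := by
  refine ⟨fun h => ?_, fun h => by rw [h, map_zero]⟩
  rw [← rePart_complexify x, h, map_zero]

/-- It suffices to test complex linearity on vertical vectors, as these span the tangent space
over `ℂ`. -/
theorem graphMapHolomorphic_of_vertical (hA : IsOpenInTS A) (hδ : ContDiffOn ℝ ∞ δ A)
    (hσ : ContDiffOn ℝ ∞ σ A) (hδ_pos : ∀ p ∈ A, 0 < δ p)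
    (hαδσ : ∀ p ∈ A, α p * δ p - σ p ^ 2 = 1)
    (h : ∀ p ∈ A, ∀ a : RSpace n, inner ℝ p.1 a = 0 → defect α δ σ p (verticalLift a) = 0) :
    GraphMapHolomorphic α δ σ A := by
  intro p hp w hw
  have hT := hA.subset hp
  set D := fderiv ℝ (graphMap δ σ) p
  have hDJ : ∀ a : RSpace n, inner ℝ p.1 a = 0 →
      D (isotropicJ α δ σ p (verticalLift a)) = Complex.I • D (verticalLift a) := by
    intro a ha
    rw [fderiv_graphMap_isotropicJ hA hδ hσ hδ_pos hαδσ hp, h p hp a ha, zero_smul, add_zero]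
  have h0 : (δ p : ℂ) ≠ 0 := by exact_mod_cast (hδ_pos p hp).ne'
  have h1 : (α p : ℂ) * δ p - σ p ^ 2 = 1 := by exact_mod_cast hαδσ p hp
  have hsm : ∀ (c : ℝ) (x : RSpace n × RSpace n), D (c • x) = (c : ℂ) • D x := by
    intro c x; rw [map_smul, Complex.coe_smul]
  -- the horizontal lift is a combination of `J a^v` and `a^v`
  have hH : ∀ a : RSpace n, inner ℝ p.1 a = 0 →
      (δ p : ℂ) • D (horizontalLift p a) = (-(σ p : ℂ) - Complex.I) • D (verticalLift a) := by
    intro a ha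
    have := hDJ a ha
    rw [isotropicJ_verticalLift ha, map_sub, hsm, hsm] at this
    push_cast at this
    linear_combination (norm := module) -this
  have hK := inner_connectionMap (w := w) hT
  have hJw : isotropicJ α δ σ p w = isotropicJ α δ σ p (horizontalLift p w.1) +
      isotropicJ α δ σ p (verticalLift (connectionMap p w)) := by
    rw [isotropicJ_horizontalLift hT, isotropicJ_verticalLift hK, isotropicJ]
  have hw' : D w = D (horizontalLift p w.1) + D (verticalLift (connectionMap p w)) := by
    rw [← map_add, horizontal_add_vertical hw]
  rw [hJw, hw', map_add, hDJ _ hK, smul_add, add_left_inj, isotropicJ_horizontalLift hT, map_add,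
    hsm, hsm]
  have hH1 := hH _ hw.1
  refine smul_right_injective _ h0 ?_
  simp only [smul_add]
  linear_combination (norm := module) (h1 + Complex.I_sq) • D (verticalLift w.1) +
    (σ p - Complex.I) • hH1

/-! ### Holomorphic charts imply involutivity -/

/-- The differentials of a chart of `TS^n` and of its inverse are inverse to each other. -/
theorem fderiv_chart {U : Set (RSpace n × RSpace n)} {V : Set (EuclideanSpace ℂ (Fin n))}
    {φ : RSpace n × RSpace n → EuclideanSpace ℂ (Fin n)}
    {ψ : EuclideanSpace ℂ (Fin n) → RSpace n × RSpace n}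
    (hU : IsOpenInTS U) (hV : IsOpen V) (hφV : Set.MapsTo φ U V) (hψU : Set.MapsTo ψ V U)
    (hinv : Set.InvOn ψ φ U V) (hφ : ContDiffOn ℝ ∞ φ U) (hψ : ContDiffOn ℝ ∞ ψ V)
    {q : RSpace n × RSpace n} (hq : q ∈ U) :
    (∀ ζ, fderiv ℝ ψ (φ q) ζ ∈ tangentTS q) ∧
      (∀ ζ, fderiv ℝ (φ ∘ retraction) q (fderiv ℝ ψ (φ q) ζ) = ζ) ∧
      ∀ w ∈ tangentTS q, fderiv ℝ ψ (φ q) (fderiv ℝ (φ ∘ retraction) q w) = w := by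
  have hqT := hU.subset hq
  have hVn : V ∈ 𝓝 (φ q) := hV.mem_nhds (hφV hq)
  have dψ : DifferentiableAt ℝ ψ (φ q) :=
    (hψ.contDiffAt hVn).differentiableAt (by simp)
  have dφ : DifferentiableAt ℝ (φ ∘ retraction) q :=
    (contDiffAt_comp_retraction hU hφ hq).differentiableAt (by simp)
  have hψq : ψ (φ q) = q := hinv.1 hq
  have hφq : (φ ∘ retraction) q = φ q := by simp [retraction_of_mem hqT]
  refine ⟨fun ζ => ?_, fun ζ => ?_, fun w hw => ?_⟩
  · rw [mem_tangentTS_iff]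
    have hc : (constraint ∘ ψ) =ᶠ[𝓝 (φ q)] fun _ => ((1, 0) : ℝ × ℝ) := by
      filter_upwards [hVn] with x hx
      exact constraint_eq_of_mem (hU.subset (hψU hx))
    have h := fderiv_comp (φ q) (g := constraint)
      ((contDiff_constraint (n := n)).differentiable (by simp) _) dψ
    rw [hc.fderiv_eq, hψq] at h
    have := congrArg (fun L => L ζ) h
    simpa using this.symm
  · have hc : ((φ ∘ retraction) ∘ ψ) =ᶠ[𝓝 (φ q)] id := by
      filter_upwards [hVn] with x hx
      simp [retraction_of_mem (hU.subset (hψU hx)), hinv.2 hx]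
    have h := fderiv_comp (φ q) (g := φ ∘ retraction) (by rwa [hψq]) dψ
    rw [hc.fderiv_eq, hψq] at h
    have := congrArg (fun L => L ζ) h
    simpa using this.symm
  · have h := fderiv_comp q (g := ψ) (by rwa [hφq]) dφ
    rw [hφq] at h
    have h2 := fderiv_apply_congr (g₁ := ψ ∘ (φ ∘ retraction)) (g₂ := id) hqT
      (DifferentiableAt.comp q (by rwa [hφq]) dφ) differentiableAt_id
      (eventually_nhdsWithin_TS hU hq fun x hx => by
        simp [retraction_of_mem (hU.subset hx), hinv.1 hx]) hw
    rw [h] at h2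
    simpa using h2

theorem isInvolutive01_of_hasHolomorphicCharts (hA : IsOpenInTS A) (hα : ContDiffOn ℝ ∞ α A)
    (hδ : ContDiffOn ℝ ∞ δ A) (hσ : ContDiffOn ℝ ∞ σ A)
    (h : HasHolomorphicCharts (isotropicJ α δ σ) A) : IsInvolutive01 (isotropicJ α δ σ) A := by
  intro X Y hX hY p hp
  obtain ⟨U, V, φ, ψ, hU, hpU, hUA, hV, hφV, hψU, hinv, hφ, hψ, hJ⟩ := h p hp
  have hchart := fun {q} hq => fderiv_chart hU hV hφV hψU hinv hφ hψ (q := q) hq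
  have hφJ : ∀ q ∈ U, ∀ w ∈ tangentTS q, fderiv ℝ (φ ∘ retraction) q (isotropicJ α δ σ q w) =
      Complex.I • fderiv ℝ (φ ∘ retraction) q w := by
    intro q hq w hw
    obtain ⟨-, h2, h3⟩ := hchart hq
    have := hJ (φ q) (hφV hq) (fderiv ℝ (φ ∘ retraction) q w)
    rw [hinv.1 hq, h3 w hw] at this
    rw [← this, h2]
  have hX' := hX.isotropicJ hA hα hδ hσ
  have hY' := hY.isotropicJ hA hα hδ hσ
  have hT : ∀ Z : RSpace n × RSpace n → RSpace n × RSpace n, IsVectorField A Z →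
      ∀ᶠ q in 𝓝[TS n] p, fderiv ℝ (φ ∘ retraction) q (isotropicJ α δ σ q (Z q)) =
        Complex.I • fderiv ℝ (φ ∘ retraction) q (Z q) + (fun _ => 0) q := fun Z hZ =>
    eventually_nhdsWithin_TS hU hpU fun q hq => by
      rw [add_zero]; exact hφJ q hq _ (hZ.2 q (hUA hq))
  have hN := fderiv_nijenhuis hA hX hY hX' hY' hp (contDiffAt_comp_retraction hU hφ hpU)
    (differentiableAt_const _) (differentiableAt_const _) (hT X hX) (hT Y hY)
  simp only [fderiv_const_apply, zero_apply, sub_zero, smul_zero,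
    add_zero] at hN
  have hB := sub_mem_tangentTS (lieBracketWithin_mem_tangentTS hA hX hY hp)
    (lieBracketWithin_mem_tangentTS hA hX' hY' hp)
  rw [← hφJ p hpU _ hB] at hN
  have h3 := (hchart hpU).2.2
  have hB' := isotropicJ_mem (α := α) (δ := δ) (σ := σ) (hA.subset hp) hB
  rw [← h3 _ hB', ← hN, h3]
  exact add_mem_tangentTS (lieBracketWithin_mem_tangentTS hA hX hY' hp)
    (lieBracketWithin_mem_tangentTS hA hX' hY hp)

/-! ### Involutivity implies complex linearity of the differential -/

theorem inner_complexify (x y : RSpace n) :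
    inner ℂ (complexify n x) (complexify n y) = ((inner ℝ x y : ℝ) : ℂ) := by
  simp [PiLp.inner_apply]

theorem exists_orthogonal (hn : 2 ≤ n) (u a : RSpace n) :
    ∃ b : RSpace n, b ≠ 0 ∧ inner ℝ u b = 0 ∧ inner ℝ a b = 0 := by
  have hlt : Submodule.span ℝ (({u, a} : Finset (RSpace n)) : Set (RSpace n)) < ⊤ := by
    refine Submodule.lt_top_of_finrank_lt_finrank ?_
    calc _ ≤ ({u, a} : Finset (RSpace n)).card := finrank_span_finset_le_card _
      _ ≤ 2 := Finset.card_le_two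
      _ < _ := by simp; omega
  have hne : (Submodule.span ℝ (({u, a} : Finset (RSpace n)) : Set (RSpace n)))ᗮ ≠ ⊥ := by
    rw [Ne, Submodule.orthogonal_eq_bot_iff]
    exact hlt.ne
  obtain ⟨b, hb, hb0⟩ := Submodule.exists_mem_ne_zero_of_ne_bot hne
  rw [Submodule.mem_orthogonal] at hb
  exact ⟨b, hb0, hb u (Submodule.subset_span (by simp)), hb a (Submodule.subset_span (by simp))⟩

/-- The vertical vector field on `TS^n` given by the tangential part of a constant vector. -/
noncomputable def verticalField (a : RSpace n) (q : RSpace n × RSpace n) : RSpace n × RSpace n :=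
  verticalLift (a - inner ℝ q.1 a • q.1)

theorem isVectorField_verticalField (hA : IsOpenInTS A) (a : RSpace n) :
    IsVectorField A (verticalField a) := by
  constructor
  · have hf : ContDiffOn ℝ ∞ (Prod.fst : RSpace n × RSpace n → RSpace n) A := contDiffOn_fst
    exact contDiffOn_const.prodMk
      (contDiffOn_const.sub ((hf.inner ℝ contDiffOn_const).smul hf))
  · intro p hp
    apply verticalLift_mem
    simp only [inner_sub_right, inner_smul_right, (hA.subset hp).1]
    ring

theorem verticalField_of_orthogonal {p : RSpace n × RSpace n} {a : RSpace n}
    (ha : inner ℝ p.1 a = 0) : verticalField a p = verticalLift a := by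
  simp [verticalField, ha]

/-- With `t_a = defect (a^v)`, involutivity forces `t_a b - t_b a ∈ ℂ u` for all `a, b ⟂ u`; as
`n ≥ 2`, there is a `b ≠ 0` orthogonal to `a` and `u`, and `t_a = 0`. -/
theorem graphMapHolomorphic_of_isInvolutive01 (hn : 2 ≤ n) (hA : IsOpenInTS A)
    (hα : ContDiffOn ℝ ∞ α A) (hδ : ContDiffOn ℝ ∞ δ A) (hσ : ContDiffOn ℝ ∞ σ A)
    (hδ_pos : ∀ p ∈ A, 0 < δ p) (hαδσ : ∀ p ∈ A, α p * δ p - σ p ^ 2 = 1)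
    (h : IsInvolutive01 (isotropicJ α δ σ) A) : GraphMapHolomorphic α δ σ A := by
  refine graphMapHolomorphic_of_vertical hA hδ hσ hδ_pos hαδσ fun p hp a ha => ?_
  have hT := hA.subset hp
  obtain ⟨b, hb0, hub, hab⟩ := exists_orthogonal hn p.1 a
  have hF := contDiffAt_graphMap hA hδ hσ hδ_pos hp
  -- the defect along a vector field, in a form that is differentiable in the ambient space
  let t : (RSpace n × RSpace n → RSpace n × RSpace n) → RSpace n × RSpace n → ℂ := fun X q =>
    inner ℂ (complexify n q.1)
      (fderiv ℝ (graphMap δ σ) q (isotropicJ α δ σ (retraction q) (X (retraction q))) -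
        Complex.I • fderiv ℝ (graphMap δ σ) q (X (retraction q)))
  have ht : ∀ X q, q ∈ A → t X q = defect α δ σ q (X q) := by
    intro X q hq
    have hqT := hA.subset hq
    have h1 := hqT.1
    simp only [t, retraction_of_mem hqT]
    rw [fderiv_graphMap_isotropicJ hA hδ hσ hδ_pos hαδσ hq, add_sub_cancel_left, inner_smul_right,
      inner_complexify, h1]
    simp
  have hc : HasFDerivAt (fun q : RSpace n × RSpace n => complexify n q.1)
    ((complexify n).comp (ContinuousLinearMap.fst ℝ _ _)) p :=
      (complexify n).hasFDerivAt.comp p hasFDerivAt_fst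
  have htd : ∀ X, IsVectorField A X → DifferentiableAt ℝ (t X) p := by
    intro X hX
    exact hc.differentiableAt.inner ℂ
      ((differentiableAt_fderiv_apply hA (hX.isotropicJ hA hα hδ hσ) hp hF).sub
        ((differentiableAt_fderiv_apply hA hX hp hF).const_smul Complex.I))
  have hed : ∀ X, IsVectorField A X → HasFDerivAt (fun q => t X q • complexify n q.1) _ p :=
    fun X hX => (htd X hX).hasFDerivAt.smul hc
  have hev : ∀ X, ∀ᶠ q in 𝓝[TS n] p, fderiv ℝ (graphMap δ σ) q (isotropicJ α δ σ q (X q)) =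
      Complex.I • fderiv ℝ (graphMap δ σ) q (X q) + t X q • complexify n q.1 := fun X =>
    eventually_nhdsWithin_TS hA hp fun q hq => by
      rw [ht X q hq]
      exact fderiv_graphMap_isotropicJ hA hδ hσ hδ_pos hαδσ hq _
  have hX := isVectorField_verticalField hA a
  have hY := isVectorField_verticalField hA b
  have hN := fderiv_nijenhuis hA hX hY (hX.isotropicJ hA hα hδ hσ) (hY.isotropicJ hA hα hδ hσ) hp
    hF (hed _ hX).differentiableAt (hed _ hY).differentiableAt (hev _) (hev _)
  rw [h _ _ hX hY p hp, fderiv_graphMap_isotropicJ hA hδ hσ hδ_pos hαδσ hp, add_right_inj,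
    (hed _ hX).fderiv, (hed _ hY).fderiv, verticalField_of_orthogonal ha,
    verticalField_of_orthogonal hub, isotropicJ_verticalLift ha, isotropicJ_verticalLift hub] at hN
  -- pairing with `b ⟂ u, a` leaves only the term `t_a b`
  have hN' := congrArg (fun w => inner ℂ (complexify n b) w) hN
  have hbu : inner ℝ b p.1 = 0 := by rw [real_inner_comm]; exact hub
  have hba : inner ℝ b a = 0 := by rw [real_inner_comm]; exact hab
  have hbb : (inner ℝ b b : ℝ) ≠ 0 := (real_inner_self_pos.2 hb0).ne'
  have hδ0 := (hδ_pos p hp).ne'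
  simp only [verticalLift, horizontalLift, add_apply,
    smul_apply, ContinuousLinearMap.smulRight_apply,
    ContinuousLinearMap.comp_apply, ContinuousLinearMap.coe_fst', Prod.fst_sub, Prod.smul_fst,
    smul_zero, zero_sub, map_neg, complexify_smul, map_zero, zero_add, inner_add_right,
    inner_sub_right, inner_smul_right, inner_neg_right, inner_complexify, hbu, hba,
    Complex.ofReal_zero, mul_zero, add_zero, sub_zero, neg_zero] at hN'
  rw [ht _ p hp, verticalField_of_orthogonal ha] at hN'
  have hbb' : ((inner ℝ b b : ℝ) : ℂ) ≠ 0 := by exact_mod_cast hbb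
  have hδ' : (δ p : ℂ) ≠ 0 := by exact_mod_cast hδ0
  simpa [hbb', hδ', hb0] using hN'

/-! ### Holomorphic hypersurfaces have complex tangent spaces -/

theorem fderiv_graphMap_verticalLift (hA : IsOpenInTS A) (hδ : ContDiffOn ℝ ∞ δ A)
    (hσ : ContDiffOn ℝ ∞ σ A) (hδ_pos : ∀ p ∈ A, 0 < δ p) {p : RSpace n × RSpace n} (hp : p ∈ A)
    (a : RSpace n) :
    fderiv ℝ (graphMap δ σ) p (verticalLift a) = complexify n a -
      fderiv ℝ (zFun δ σ ∘ retraction) p (verticalLift a) • complexify n p.1 := by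
  rw [fderiv_graphMap hA hδ hσ hδ_pos hp]
  simp [verticalLift]

theorem image_Phi_eq (hA : IsOpenInTS A) :
    (fun p => Phi p (zFun δ σ p)) '' A = graphMap δ σ '' A :=
  Set.image_congr fun _ hp => (graphMap_of_mem (hA.subset hp)).symm

/-- The kernel of `dh` contains the vectors `dF (a^v) = a - dz(a^v) u` for all `a ⟂ u`, hence does
not contain `u`; so `dF (J a^v) - i dF (a^v) ∈ ℂ u ∩ ker dh = 0`. -/
theorem graphMapHolomorphic_of_isHolomorphicHypersurface (hA : IsOpenInTS A)
    (hδ : ContDiffOn ℝ ∞ δ A) (hσ : ContDiffOn ℝ ∞ σ A)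
    (hδ_pos : ∀ p ∈ A, 0 < δ p) (hαδσ : ∀ p ∈ A, α p * δ p - σ p ^ 2 = 1)
    (h : IsHolomorphicHypersurface (graphMap δ σ '' A) (complexMinusReal n)) :
    GraphMapHolomorphic α δ σ A := by
  refine graphMapHolomorphic_of_vertical hA hδ hσ hδ_pos hαδσ fun p hp a ha => ?_
  have hT := hA.subset hp
  obtain ⟨W, g, hW, hpW, -, hg, hg0, hSW⟩ := h.2 _ (Set.mem_image_of_mem _ hp)
  have hF := contDiffAt_graphMap hA hδ hσ hδ_pos hp
  have hFd := hF.differentiableAt (by simp)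
  have hWn := hW.mem_nhds hpW
  have hgd := (hg.differentiableAt hWn).hasFDerivAt
  set L := fderiv ℂ g (graphMap δ σ p) with hL
  have hcomp : HasFDerivAt (g ∘ graphMap δ σ) _ p :=
    (hgd.restrictScalars ℝ).comp p hFd.hasFDerivAt
  have htan : ∀ w ∈ tangentTS p, L (fderiv ℝ (graphMap δ σ) p w) = 0 := by
    intro w hw
    have := fderiv_apply_congr (g₂ := fun _ => (0 : ℂ)) hT hcomp.differentiableAt
      (differentiableAt_const _) (w := w) ?_ hw
    · rw [hcomp.fderiv] at this
      simpa using this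
    · filter_upwards [hA.mem_nhdsWithin hp,
        nhdsWithin_le_nhds (hF.continuousAt.preimage_mem_nhds hWn)] with q hq hqW
      have : graphMap δ σ q ∈ graphMap δ σ '' A ∩ W := ⟨Set.mem_image_of_mem _ hq, hqW⟩
      rw [hSW] at this
      exact this.2
  have hu : L (complexify n p.1) ≠ 0 := by
    intro hu
    have hperp : ∀ b : RSpace n, inner ℝ p.1 b = 0 → L (complexify n b) = 0 := by
      intro b hb
      have := htan _ (verticalLift_mem hb)
      rw [fderiv_graphMap_verticalLift hA hδ hσ hδ_pos hp, map_sub, map_smul, hu, smul_zero,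
        sub_zero] at this
      exact this
    have hreal : ∀ x : RSpace n, L (complexify n x) = 0 := by
      intro x
      have hx : x = (x - inner ℝ p.1 x • p.1) + inner ℝ p.1 x • p.1 := by abel
      rw [hx, map_add, complexify_smul, map_add, map_smul, hu, smul_zero, add_zero]
      apply hperp
      simp only [inner_sub_right, inner_smul_right, hT.1]
      ring
    apply hg0 _ hpW
    ext1 w
    rw [← hL, ← complexify_re_add_im w, map_add, map_smul, hreal, hreal]
    simp
  have h1 := htan _ (isotropicJ_mem (α := α) (δ := δ) (σ := σ) hT (verticalLift_mem ha))
  rw [fderiv_graphMap_isotropicJ hA hδ hσ hδ_pos hαδσ hp, map_add, map_smul, map_smul,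
    htan _ (verticalLift_mem ha), smul_zero, zero_add, smul_eq_mul] at h1
  exact (mul_eq_zero.1 h1).resolve_right hu

/-! ### The inverse of the map `(u, v, z) ↦ v - z u` -/

/-- The point `u = -Im w / |Im w|` of the sphere with `w = v - z u`. -/
noncomputable def spherePart (w : CSpace n) : RSpace n := -(‖imPart n w‖⁻¹ • imPart n w)

/-- The point `(u, v)` of `TS^n` with `w = v - z u`. -/
noncomputable def bundlePart (w : CSpace n) : RSpace n × RSpace n :=
  (spherePart w, rePart n w - inner ℝ (rePart n w) (spherePart w) • spherePart w)

/-- The point `z` of the upper half plane with `w = v - z u`. -/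
noncomputable def heightPart (w : CSpace n) : ℂ :=
  -((inner ℝ (rePart n w) (spherePart w) : ℝ) : ℂ) + (‖imPart n w‖ : ℂ) * Complex.I

theorem inner_spherePart {w : CSpace n} (hw : imPart n w ≠ 0) :
    inner ℝ (spherePart w) (spherePart w) = 1 := by
  have : ‖imPart n w‖ ≠ 0 := norm_ne_zero_iff.2 hw
  rw [real_inner_self_eq_norm_sq, spherePart, norm_neg, norm_smul, norm_inv, norm_norm,
    inv_mul_cancel₀ this, one_pow]

theorem bundlePart_mem {w : CSpace n} (hw : imPart n w ≠ 0) : bundlePart w ∈ TS n := by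
  have h := inner_spherePart hw
  refine ⟨h, ?_⟩
  simp only [bundlePart, inner_sub_right, inner_smul_right, h]
  rw [real_inner_comm]
  ring

theorem Phi_bundlePart {w : CSpace n} (hw : imPart n w ≠ 0) :
    Phi (bundlePart w) (heightPart w) = w := by
  have h0 : (‖imPart n w‖ : ℂ) ≠ 0 := by exact_mod_cast norm_ne_zero_iff.2 hw
  have h1 : (‖imPart n w‖ : ℂ) • complexify n (spherePart w) = -complexify n (imPart n w) := by
    rw [spherePart, map_neg, complexify_smul, smul_neg, smul_smul, Complex.ofReal_inv,
      mul_inv_cancel₀ h0, one_smul]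
  conv_rhs => rw [← complexify_re_add_im w]
  rw [Phi_eq, bundlePart, heightPart, map_sub, complexify_smul]
  linear_combination (norm := module) (-Complex.I) • h1

theorem imPart_Phi (p : RSpace n × RSpace n) (z : ℂ) : imPart n (Phi p z) = -(z.im • p.1) := by
  rw [Phi_eq, map_sub, imPart_complexify, imPart_smul_complexify, zero_sub]

theorem rePart_Phi (p : RSpace n × RSpace n) (z : ℂ) :
    rePart n (Phi p z) = p.2 - z.re • p.1 := by
  rw [Phi_eq, map_sub, rePart_complexify, rePart_smul_complexify]

theorem imPart_Phi_ne_zero {p : RSpace n × RSpace n} (hp : p ∈ TS n) {z : ℂ} (hz : 0 < z.im) :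
    imPart n (Phi p z) ≠ 0 := by
  rw [imPart_Phi, neg_ne_zero]
  exact smul_ne_zero hz.ne' (fst_ne_zero hp)

theorem norm_fst {p : RSpace n × RSpace n} (hp : p ∈ TS n) : ‖p.1‖ = 1 := by
  have h := hp.1
  rw [real_inner_self_eq_norm_sq] at h
  exact (pow_eq_one_iff_of_nonneg (norm_nonneg _) two_ne_zero).1 h

theorem spherePart_Phi {p : RSpace n × RSpace n} (hp : p ∈ TS n) {z : ℂ} (hz : 0 < z.im) :
    spherePart (Phi p z) = p.1 := by
  rw [spherePart, imPart_Phi, norm_neg, norm_smul, norm_fst hp, mul_one, Real.norm_of_nonneg hz.le,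
    smul_neg, neg_neg, smul_smul, inv_mul_cancel₀ hz.ne', one_smul]

theorem inner_rePart_Phi {p : RSpace n × RSpace n} (hp : p ∈ TS n) (z : ℂ) :
    inner ℝ (rePart n (Phi p z)) p.1 = -z.re := by
  rw [rePart_Phi, inner_sub_left, inner_smul_left, hp.1, real_inner_comm, hp.2]
  simp

theorem bundlePart_Phi {p : RSpace n × RSpace n} (hp : p ∈ TS n) {z : ℂ} (hz : 0 < z.im) :
    bundlePart (Phi p z) = p := by
  rw [bundlePart, spherePart_Phi hp hz, inner_rePart_Phi hp, rePart_Phi]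
  ext1 <;> simp

theorem heightPart_Phi {p : RSpace n × RSpace n} (hp : p ∈ TS n) {z : ℂ} (hz : 0 < z.im) :
    heightPart (Phi p z) = z := by
  rw [heightPart, spherePart_Phi hp hz, inner_rePart_Phi hp, imPart_Phi, norm_neg, norm_smul,
    norm_fst hp, mul_one, Real.norm_of_nonneg hz.le]
  simp

theorem contDiffAt_spherePart {w : CSpace n} (hw : imPart n w ≠ 0) :
    ContDiffAt ℝ ∞ spherePart w := by
  have h : ContDiffAt ℝ ∞ (imPart n) w := (imPart n).contDiff.contDiffAt
  exact (((h.norm ℝ hw).inv (norm_ne_zero_iff.2 hw)).smul h).neg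

theorem contDiffAt_bundlePart {w : CSpace n} (hw : imPart n w ≠ 0) :
    ContDiffAt ℝ ∞ bundlePart w := by
  have h : ContDiffAt ℝ ∞ (rePart n) w := (rePart n).contDiff.contDiffAt
  have hs := contDiffAt_spherePart hw
  exact hs.prodMk (h.sub ((h.inner ℝ hs).smul hs))

theorem contDiffAt_heightPart {w : CSpace n} (hw : imPart n w ≠ 0) :
    ContDiffAt ℝ ∞ heightPart w := by
  have h : ContDiffAt ℝ ∞ (rePart n) w := (rePart n).contDiff.contDiffAt
  have h' : ContDiffAt ℝ ∞ (imPart n) w := (imPart n).contDiff.contDiffAt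
  have hs := contDiffAt_spherePart hw
  exact (Complex.ofRealCLM.contDiff.contDiffAt.comp w (h.inner ℝ hs)).neg.add
    ((Complex.ofRealCLM.contDiff.contDiffAt.comp w (h'.norm ℝ hw)).mul contDiffAt_const)

/-! ### A defining function of the hypersurface -/

/-- The smooth function `z(u, v) - z`, in terms of `w = v - z u`, whose zero set is the
hypersurface. -/
noncomputable def graphDefect (δ σ : RSpace n × RSpace n → ℝ) (w : CSpace n) : ℂ :=
  zFun δ σ (bundlePart w) - heightPart w

/-- The points `v - z u` with `(u, v) ∈ A`. -/
def tube (A : Set (RSpace n × RSpace n)) : Set (CSpace n) :=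
  {w | imPart n w ≠ 0 ∧ bundlePart w ∈ A}

theorem isOpen_imPart_ne_zero : IsOpen {w : CSpace n | imPart n w ≠ 0} :=
  isOpen_ne_fun (imPart n).continuous continuous_const

theorem isOpen_tube (hA : IsOpenInTS A) : IsOpen (tube A) := by
  obtain ⟨O, hO, rfl⟩ := hA
  have hc : ContinuousOn (bundlePart (n := n)) {w | imPart n w ≠ 0} := fun w hw =>
    (contDiffAt_bundlePart hw).continuousAt.continuousWithinAt
  convert hc.isOpen_inter_preimage isOpen_imPart_ne_zero hO using 1
  ext w
  exact ⟨fun h => ⟨h.1, h.2.1⟩, fun h => ⟨h.1, h.2, bundlePart_mem h.1⟩⟩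

theorem contDiffOn_graphDefect (hδ : ContDiffOn ℝ ∞ δ A)
    (hσ : ContDiffOn ℝ ∞ σ A) (hδ_pos : ∀ p ∈ A, 0 < δ p) :
    ContDiffOn ℝ ∞ (graphDefect δ σ) (tube A) := by
  refine ContDiffOn.sub ((contDiffOn_zFun hδ hσ hδ_pos).comp (f := bundlePart) ?_ fun w hw => hw.2)
    fun w hw => (contDiffAt_heightPart hw.1).contDiffWithinAt
  exact fun w hw => (contDiffAt_bundlePart hw.1).contDiffWithinAt

theorem zFun_im_pos (hδ_pos : ∀ p ∈ A, 0 < δ p) {p : RSpace n × RSpace n} (hp : p ∈ A) :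
    0 < (zFun δ σ p).im := by
  rw [zFun_im]
  exact inv_pos.2 (hδ_pos p hp)

theorem graphMap_mem_tube (hA : IsOpenInTS A) (hδ_pos : ∀ p ∈ A, 0 < δ p)
    {p : RSpace n × RSpace n} (hp : p ∈ A) : graphMap δ σ p ∈ tube A := by
  have hT := hA.subset hp
  have hz := zFun_im_pos (σ := σ) hδ_pos hp
  rw [graphMap_of_mem hT]
  exact ⟨imPart_Phi_ne_zero hT hz, by rwa [bundlePart_Phi hT hz]⟩

theorem bundlePart_graphMap (hA : IsOpenInTS A) (hδ_pos : ∀ p ∈ A, 0 < δ p)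
    {p : RSpace n × RSpace n} (hp : p ∈ A) : bundlePart (graphMap δ σ p) = p := by
  rw [graphMap_of_mem (hA.subset hp), bundlePart_Phi (hA.subset hp) (zFun_im_pos hδ_pos hp)]

theorem graphDefect_graphMap (hA : IsOpenInTS A) (hδ_pos : ∀ p ∈ A, 0 < δ p)
    {p : RSpace n × RSpace n} (hp : p ∈ A) : graphDefect δ σ (graphMap δ σ p) = 0 := by
  rw [graphDefect, bundlePart_graphMap hA hδ_pos hp, graphMap_of_mem (hA.subset hp),
    heightPart_Phi (hA.subset hp) (zFun_im_pos hδ_pos hp), sub_self]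

theorem graphMap_bundlePart {w : CSpace n} (hw : w ∈ tube A) (h : graphDefect δ σ w = 0) :
    graphMap δ σ (bundlePart w) = w := by
  rw [graphMap_of_mem (bundlePart_mem hw.1), sub_eq_zero.1 h, Phi_bundlePart hw.1]

/-- Moving `w = v - z u` along `ℂ u` moves `z` and fixes `(u, v)`. -/
theorem fderiv_graphDefect (hA : IsOpenInTS A) (hδ : ContDiffOn ℝ ∞ δ A)
    (hσ : ContDiffOn ℝ ∞ σ A) (hδ_pos : ∀ p ∈ A, 0 < δ p) {p : RSpace n × RSpace n} (hp : p ∈ A)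
    (c : ℂ) : fderiv ℝ (graphDefect δ σ) (graphMap δ σ p) (c • complexify n p.1) = c := by
  have hT := hA.subset hp
  have hz := zFun_im_pos (σ := σ) hδ_pos hp
  let l : ℂ → CSpace n := fun c => graphMap δ σ p + c • complexify n p.1
  have hl : HasFDerivAt l ((ContinuousLinearMap.id ℝ ℂ).smulRight (complexify n p.1)) 0 :=
    ((hasFDerivAt_id (𝕜 := ℝ) (0 : ℂ)).smul_const (complexify n p.1)).const_add _
  have hl0 : l 0 = graphMap δ σ p := by simp [l]
  have hk : DifferentiableAt ℝ (graphDefect δ σ) (l 0) := by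
    rw [hl0]
    exact ((contDiffOn_graphDefect hδ hσ hδ_pos).contDiffAt
      ((isOpen_tube hA).mem_nhds (graphMap_mem_tube hA hδ_pos hp))).differentiableAt (by simp)
  have hlk : graphDefect δ σ ∘ l =ᶠ[𝓝 0] id := by
    have hev : ∀ᶠ c : ℂ in 𝓝 0, 0 < (zFun δ σ p - c).im := by
      have : Continuous fun c : ℂ => (zFun δ σ p - c).im := by fun_prop
      exact this.continuousAt.eventually_const_lt (by simpa using hz)
    filter_upwards [hev] with c hc
    have e : l c = Phi p (zFun δ σ p - c) := by
      simp only [l, graphMap_of_mem hT, Phi_eq]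
      module
    simp only [Function.comp_apply, e, graphDefect, bundlePart_Phi hT hc, heightPart_Phi hT hc, id]
    ring
  have h := (hk.hasFDerivAt.comp 0 hl).fderiv
  rw [hlk.fderiv_eq, hl0] at h
  have := congrArg (fun L => L c) h
  simpa using this.symm

/-! ### Complex linearity gives holomorphic charts and a holomorphic equation -/

theorem exists_openPartialHomeomorph {E F : Type*} [NormedAddCommGroup E] [NormedSpace ℝ E]
    [CompleteSpace E] [NormedAddCommGroup F] [NormedSpace ℝ F] {f : E → F} {Ω : Set E}
    (hΩ : IsOpen Ω) (hf : ContDiffOn ℝ ∞ f Ω) {x : E} (hx : x ∈ Ω) (f' : E ≃L[ℝ] F)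
    (hf' : HasFDerivAt f (f' : E →L[ℝ] F) x) :
    ∃ T : OpenPartialHomeomorph E F, x ∈ T.source ∧ T.source ⊆ Ω ∧ (∀ y, T y = f y) ∧
      ContDiffOn ℝ ∞ T.symm T.target := by
  have hfx := hf.contDiffAt (hΩ.mem_nhds hx)
  have hn : (∞ : ℕ∞ω) ≠ 0 := by simp
  have hcont : ContinuousAt (fderiv ℝ f) x :=
    (hfx.fderiv_right (m := 1) (by rw [one_add_one_eq_two]; exact ENat.LEInfty.out)).continuousAt
  -- smoothness of the inverse on a whole neighbourhood requires `f'` invertible nearby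
  have hinv : ∀ᶠ y in 𝓝 x, fderiv ℝ f y ∈ Set.range ((↑) : (E ≃L[ℝ] F) → E →L[ℝ] F) :=
    hcont.eventually_mem (by rw [hf'.fderiv]; exact f'.nhds)
  obtain ⟨t, ht, hto, hxt⟩ := mem_nhds_iff.1 (hinv.and (hΩ.mem_nhds hx))
  refine ⟨(hfx.toOpenPartialHomeomorph f hf' hn).restrOpen t hto,
    ⟨hfx.mem_toOpenPartialHomeomorph_source hf' hn, hxt⟩, fun y hy => (ht hy.2).2,
    fun y => rfl, fun a ha => ?_⟩
  set T := (hfx.toOpenPartialHomeomorph f hf' hn).restrOpen t hto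
  have hm : T.symm a ∈ t := (T.map_target ha).2
  obtain ⟨⟨g, hg⟩, hΩm⟩ := ht hm
  have hfa := hf.contDiffAt (hΩ.mem_nhds hΩm)
  refine (T.contDiffAt_symm ha (f₀' := g) ?_ hfa).contDiffWithinAt
  rw [hg]
  exact (hfa.differentiableAt hn).hasFDerivAt

theorem exists_splitting {u : CSpace n} (hu : u ≠ 0) :
    ∃ e : CSpace n ≃L[ℂ] EuclideanSpace ℂ (Fin n) × ℂ, e u = (0, 1) := by
  have e₀ : CSpace n ≃L[ℂ] EuclideanSpace ℂ (Fin n) × ℂ :=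
    ContinuousLinearEquiv.ofFinrankEq (by simp)
  obtain ⟨g, hg⟩ := SeparatingDual.exists_continuousLinearEquiv_apply_eq (R := ℂ)
    (x := e₀ u) (y := ((0, 1) : EuclideanSpace ℂ (Fin n) × ℂ)) (by simpa using hu) (by simp)
  exact ⟨e₀.trans g, hg⟩

/-- Near each of its points, the image of `A` is the graph of a smooth function over an open subset
`V` of `ℂ^n`, in linear coordinates `e` of `ℂ^{n+1}` the last of which is along `u`. -/
theorem exists_graph_parametrization (hA : IsOpenInTS A) (hδ : ContDiffOn ℝ ∞ δ A)
    (hσ : ContDiffOn ℝ ∞ σ A) (hδ_pos : ∀ p ∈ A, 0 < δ p) {p : RSpace n × RSpace n} (hp : p ∈ A) :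
    ∃ (e : CSpace n ≃L[ℂ] EuclideanSpace ℂ (Fin n) × ℂ) (N : Set (CSpace n))
      (V : Set (EuclideanSpace ℂ (Fin n))) (τ : EuclideanSpace ℂ (Fin n) → CSpace n),
      IsOpen N ∧ graphMap δ σ p ∈ N ∧ N ⊆ tube A ∧ IsOpen V ∧ ContDiffOn ℝ ∞ τ V ∧
      (∀ ζ ∈ V, τ ζ ∈ N ∧ graphMap δ σ (bundlePart (τ ζ)) = τ ζ ∧ (e (τ ζ)).1 = ζ) ∧
      ∀ q ∈ A, graphMap δ σ q ∈ N →
        (e (graphMap δ σ q)).1 ∈ V ∧ τ (e (graphMap δ σ q)).1 = graphMap δ σ q := by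
  have hT := hA.subset hp
  obtain ⟨e, he⟩ := exists_splitting (u := complexify n p.1)
    (by rw [Ne, complexify_eq_zero_iff]; exact fst_ne_zero hT)
  have hpt := graphMap_mem_tube (σ := σ) hA hδ_pos hp
  have hk := contDiffOn_graphDefect hδ hσ hδ_pos
  have hkd := ((hk.contDiffAt ((isOpen_tube hA).mem_nhds hpt)).differentiableAt
    (by simp)).hasFDerivAt
  let π : CSpace n →L[ℝ] EuclideanSpace ℂ (Fin n) :=
    ((ContinuousLinearMap.fst ℂ _ ℂ).comp
      (e : CSpace n →L[ℂ] EuclideanSpace ℂ (Fin n) × ℂ)).restrictScalars ℝ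
  have hD : HasFDerivAt (fun w => (π w, graphDefect δ σ w)) _ (graphMap δ σ p) :=
    π.hasFDerivAt.prodMk hkd
  set D := π.prod (fderiv ℝ (graphDefect δ σ) (graphMap δ σ p))
  have hinj : Function.Injective (D : CSpace n →ₗ[ℝ] EuclideanSpace ℂ (Fin n) × ℂ) := by
    rw [← LinearMap.ker_eq_bot, LinearMap.ker_eq_bot']
    intro w hw
    have h1 : (e w).1 = 0 := congrArg Prod.fst hw
    have h2 : fderiv ℝ (graphDefect δ σ) (graphMap δ σ p) w = 0 := congrArg Prod.snd hw
    have h3 : w = (e w).2 • complexify n p.1 := by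
      apply e.injective
      rw [map_smul, he]
      ext1 <;> simp [h1]
    rw [h3, fderiv_graphDefect hA hδ hσ hδ_pos hp] at h2
    rw [h3, h2, zero_smul]
  let D' : CSpace n ≃L[ℝ] EuclideanSpace ℂ (Fin n) × ℂ :=
    (LinearMap.linearEquivOfInjective _ hinj
      (e.toLinearEquiv.restrictScalars ℝ).finrank_eq).toContinuousLinearEquiv
  have hD' : (D' : CSpace n →L[ℝ] EuclideanSpace ℂ (Fin n) × ℂ) = D := by
    ext1 w; rfl
  obtain ⟨T, hTp, hTA, hTf, hTs⟩ := exists_openPartialHomeomorph (isOpen_tube hA)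
    (π.contDiff.contDiffOn.prodMk hk) hpt D' (by rw [hD']; exact hD)
  have hV : Continuous fun ζ : EuclideanSpace ℂ (Fin n) => (ζ, (0 : ℂ)) := by fun_prop
  refine ⟨e, T.source, {ζ | (ζ, (0 : ℂ)) ∈ T.target}, fun ζ => T.symm (ζ, 0), T.open_source, hTp,
    hTA, T.open_target.preimage hV, ?_, fun ζ hζ => ?_, fun q hq hqN => ?_⟩
  · exact hTs.comp (contDiff_id.prodMk contDiff_const).contDiffOn fun ζ hζ => hζ
  · have hm := T.map_target hζ
    have h := T.right_inv hζ
    rw [hTf] at h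
    exact ⟨hm, graphMap_bundlePart (hTA hm) (congrArg Prod.snd h), congrArg Prod.fst h⟩
  · have h : T (graphMap δ σ q) = ((e (graphMap δ σ q)).1, 0) := by
      rw [hTf, graphDefect_graphMap hA hδ_pos hq]
      rfl
    refine ⟨?_, ?_⟩
    · have := T.map_source hqN
      rwa [h] at this
    · have := T.left_inv hqN
      rwa [h] at this

theorem differentiableAt_complex_of_fderiv_I_smul {E F : Type*} [NormedAddCommGroup E]
    [NormedSpace ℂ E] [NormedAddCommGroup F] [NormedSpace ℂ F] {f : E → F} {x : E}
    (hf : DifferentiableAt ℝ f x)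
    (h : ∀ ζ, fderiv ℝ f x (Complex.I • ζ) = Complex.I • fderiv ℝ f x ζ) :
    DifferentiableAt ℂ f x := by
  let L : E →L[ℂ] F :=
    { toFun := fderiv ℝ f x
      map_add' := map_add _
      map_smul' := fun c ζ => by
        have hc : c • ζ = c.re • ζ + c.im • (Complex.I • ζ) := by
          conv_lhs => rw [← Complex.re_add_im c]
          rw [add_smul, mul_smul, Complex.coe_smul, Complex.coe_smul]
        have hc' : c • fderiv ℝ f x ζ =
            c.re • fderiv ℝ f x ζ + c.im • (Complex.I • fderiv ℝ f x ζ) := by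
          conv_lhs => rw [← Complex.re_add_im c]
          rw [add_smul, mul_smul, Complex.coe_smul, Complex.coe_smul]
        rw [RingHom.id_apply, hc, hc', map_add, map_smul, map_smul, h]
      cont := (fderiv ℝ f x).continuous }
  exact (hasFDerivAt_of_restrictScalars ℝ (g' := fderiv ℝ f x) (f' := L) hf.hasFDerivAt
    rfl).differentiableAt

/-- If the differential of `(u, v) ↦ v - z(u, v) u` is complex linear, then near each of its points
the image of `A` is the graph of a holomorphic function over an open subset of `ℂ^n`, and the
linear coordinates of `ℂ^n` are holomorphic coordinates of `A`. -/
theorem exists_holomorphic_parametrization (hA : IsOpenInTS A) (hδ : ContDiffOn ℝ ∞ δ A)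
    (hσ : ContDiffOn ℝ ∞ σ A) (hδ_pos : ∀ p ∈ A, 0 < δ p) (h : GraphMapHolomorphic α δ σ A)
    {p : RSpace n × RSpace n} (hp : p ∈ A) :
    ∃ (e : CSpace n ≃L[ℂ] EuclideanSpace ℂ (Fin n) × ℂ) (N : Set (CSpace n))
      (U : Set (RSpace n × RSpace n)) (V : Set (EuclideanSpace ℂ (Fin n)))
      (ψ : EuclideanSpace ℂ (Fin n) → RSpace n × RSpace n),
      IsOpen N ∧ N ⊆ tube A ∧ IsOpenInTS U ∧ p ∈ U ∧ U = {q ∈ A | graphMap δ σ q ∈ N} ∧ IsOpen V ∧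
      Set.MapsTo (fun q => (e (graphMap δ σ q)).1) U V ∧ Set.MapsTo ψ V U ∧
      Set.InvOn ψ (fun q => (e (graphMap δ σ q)).1) U V ∧
      ContDiffOn ℝ ∞ (fun q => (e (graphMap δ σ q)).1) U ∧ ContDiffOn ℝ ∞ ψ V ∧
      (∀ x ∈ V, ∀ ζ, fderiv ℝ ψ x (Complex.I • ζ) =
        isotropicJ α δ σ (ψ x) (fderiv ℝ ψ x ζ)) ∧
      DifferentiableOn ℂ (fun x => graphMap δ σ (ψ x)) V := by
  obtain ⟨e, N, V, τ, hN, hpN, hNA, hV, hτ, hVτ, hAV⟩ :=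
    exists_graph_parametrization hA hδ hσ hδ_pos hp
  set φ : RSpace n × RSpace n → EuclideanSpace ℂ (Fin n) := fun q => (e (graphMap δ σ q)).1 with hφ
  set U : Set (RSpace n × RSpace n) := {q ∈ A | graphMap δ σ q ∈ N} with hU
  let ψ : EuclideanSpace ℂ (Fin n) → RSpace n × RSpace n := fun ζ => bundlePart (τ ζ)
  have hF : ∀ q ∈ A, ContDiffAt ℝ ∞ (graphMap δ σ) q := fun q hq =>
    contDiffAt_graphMap hA hδ hσ hδ_pos hq
  have hUo : IsOpenInTS U := by
    have hc : ContinuousOn (graphMap δ σ) A := fun q hq =>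
      (hF q hq).continuousAt.continuousWithinAt
    obtain ⟨O', hO', hOA⟩ := continuousOn_iff'.1 hc N hN
    obtain ⟨O, hO, rfl⟩ := hA
    refine ⟨O' ∩ O, hO'.inter hO, ?_⟩
    rw [Set.inter_assoc, ← hOA]
    ext q
    exact and_comm
  let π : CSpace n →L[ℝ] EuclideanSpace ℂ (Fin n) :=
    ((ContinuousLinearMap.fst ℂ _ ℂ).comp
      (e : CSpace n →L[ℂ] EuclideanSpace ℂ (Fin n) × ℂ)).restrictScalars ℝ
  have hφs : ContDiffOn ℝ ∞ φ U := fun q hq =>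
    (π.contDiff.contDiffAt.comp q (hF q hq.1)).contDiffWithinAt
  have hψs : ContDiffOn ℝ ∞ ψ V := fun x hx =>
    (contDiffAt_bundlePart (hNA (hVτ x hx).1).1).comp_contDiffWithinAt x (hτ x hx)
  have hφV : Set.MapsTo φ U V := fun q hq => (hAV q hq.1 hq.2).1
  have hψU : Set.MapsTo ψ V U := fun x hx => by
    obtain ⟨h1, h2, -⟩ := hVτ x hx
    exact ⟨(hNA h1).2, by rw [h2]; exact h1⟩
  have hinv : Set.InvOn ψ φ U V := by
    refine ⟨fun q hq => ?_, fun x hx => ?_⟩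
    · simp only [ψ, φ]
      rw [(hAV q hq.1 hq.2).2, bundlePart_graphMap hA hδ_pos hq.1]
    · obtain ⟨-, h2, h3⟩ := hVτ x hx
      simp only [ψ, φ]
      rw [h2, h3]
  -- `dφ` is complex linear because `dF` is
  have hφJ : ∀ q ∈ U, ∀ w ∈ tangentTS q, fderiv ℝ (φ ∘ retraction) q (isotropicJ α δ σ q w) =
      Complex.I • fderiv ℝ (φ ∘ retraction) q w := by
    intro q hq w hw
    have hqT := hUo.subset hq
    have hd := ((hF q hq.1).differentiableAt (by simp)).hasFDerivAt
    have hφd : HasFDerivAt φ (π.comp (fderiv ℝ (graphMap δ σ) q)) q := π.hasFDerivAt.comp q hd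
    have hext : ∀ w ∈ tangentTS q, fderiv ℝ (φ ∘ retraction) q w =
        π (fderiv ℝ (graphMap δ σ) q w) := by
      intro w hw
      rw [fderiv_apply_congr (g₂ := φ) hqT
        ((contDiffAt_comp_retraction hUo hφs hq).differentiableAt (by simp)) hφd.differentiableAt
        ?_ hw, hφd.fderiv]
      · rfl
      · filter_upwards [self_mem_nhdsWithin] with x hx
        simp [retraction_of_mem hx]
    rw [hext _ (isotropicJ_mem hqT hw), hext _ hw, h q hq.1 w hw]
    simp [π]
  have hψJ : ∀ x ∈ V, ∀ ζ, fderiv ℝ ψ x ζ ∈ tangentTS (ψ x) ∧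
      fderiv ℝ ψ x (Complex.I • ζ) = isotropicJ α δ σ (ψ x) (fderiv ℝ ψ x ζ) := by
    intro x hx ζ
    have hq := hψU hx
    obtain ⟨h1, h2, h3⟩ := fderiv_chart hUo hV hφV hψU hinv hφs hψs hq
    rw [hinv.2 hx] at h1 h2 h3
    refine ⟨h1 ζ, ?_⟩
    rw [← h3 _ (isotropicJ_mem (hUo.subset hq) (h1 ζ)), hφJ _ hq _ (h1 ζ), h2]
  refine ⟨e, N, U, V, ψ, hN, hNA, hUo, ⟨hp, hpN⟩, hU, hV, hφV, hψU, hinv, hφs, hψs,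
    fun x hx ζ => (hψJ x hx ζ).2, fun x hx => ?_⟩
  have hd := ((hF _ (hψU hx).1).differentiableAt (by simp)).hasFDerivAt
  have hψd := ((hψs.contDiffAt (hV.mem_nhds hx)).differentiableAt (by simp)).hasFDerivAt
  have hcomp : HasFDerivAt (fun x => graphMap δ σ (ψ x)) _ x := hd.comp x hψd
  refine (differentiableAt_complex_of_fderiv_I_smul hcomp.differentiableAt
    fun ζ => ?_).differentiableWithinAt
  rw [hcomp.fderiv]
  simp only [ContinuousLinearMap.comp_apply, (hψJ x hx ζ).2]
  exact h _ (hψU hx).1 _ (hψJ x hx ζ).1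

theorem hasHolomorphicCharts_of_graphMapHolomorphic (hA : IsOpenInTS A)
    (hδ : ContDiffOn ℝ ∞ δ A) (hσ : ContDiffOn ℝ ∞ σ A) (hδ_pos : ∀ p ∈ A, 0 < δ p)
    (h : GraphMapHolomorphic α δ σ A) : HasHolomorphicCharts (isotropicJ α δ σ) A := by
  intro p hp
  obtain ⟨e, N, U, V, ψ, -, -, hUo, hpU, hU, hV, h1, h2, h3, h4, h5, h6, -⟩ :=
    exists_holomorphic_parametrization hA hδ hσ hδ_pos h hp
  exact ⟨U, V, _, ψ, hUo, hpU, hU ▸ Set.sep_subset _ _, hV, h1, h2, h3, h4, h5, h6⟩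

theorem isHolomorphicHypersurface_of_graphMapHolomorphic (hA : IsOpenInTS A)
    (hδ : ContDiffOn ℝ ∞ δ A) (hσ : ContDiffOn ℝ ∞ σ A) (hδ_pos : ∀ p ∈ A, 0 < δ p)
    (h : GraphMapHolomorphic α δ σ A) :
    IsHolomorphicHypersurface (graphMap δ σ '' A) (complexMinusReal n) := by
  refine ⟨?_, ?_⟩
  · rintro _ ⟨p, hp, rfl⟩
    exact (mem_complexMinusReal_iff _).2 (graphMap_mem_tube hA hδ_pos hp).1
  rintro _ ⟨p, hp, rfl⟩
  obtain ⟨e, N, U, V, ψ, hN, hNA, hUo, hpU, hU, hV, hφV, hψU, hinv, -, -, -, hτ⟩ :=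
    exists_holomorphic_parametrization hA hδ hσ hδ_pos h hp
  let g : EuclideanSpace ℂ (Fin n) → ℂ := fun x => (e (graphMap δ σ (ψ x))).2
  have hg : DifferentiableOn ℂ g V := by
    have he : Differentiable ℂ fun w => (e w).2 := e.differentiable.snd
    exact he.comp_differentiableOn hτ
  have hfst : Continuous fun w => (e w).1 := e.continuous.fst
  have hder : ∀ w ∈ N ∩ {w | (e w).1 ∈ V},
      HasFDerivAt (fun w => g (e w).1 - (e w).2) ((fderiv ℂ g (e w).1).comp
        ((ContinuousLinearMap.fst ℂ _ ℂ).comp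
          (e : CSpace n →L[ℂ] EuclideanSpace ℂ (Fin n) × ℂ)) -
        (ContinuousLinearMap.snd ℂ _ ℂ).comp
          (e : CSpace n →L[ℂ] EuclideanSpace ℂ (Fin n) × ℂ)) w := by
    intro w hw
    have hgd := (hg.differentiableAt (hV.mem_nhds hw.2)).hasFDerivAt
    exact (hgd.comp w (hasFDerivAt_fst.comp w e.hasFDerivAt)).sub
      (hasFDerivAt_snd.comp w e.hasFDerivAt)
  refine ⟨N ∩ {w | (e w).1 ∈ V}, fun w => g (e w).1 - (e w).2, hN.inter (hV.preimage hfst), ?_,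
    fun w hw => (mem_complexMinusReal_iff _).2 (hNA hw.1).1,
    fun w hw => (hder w hw).differentiableAt.differentiableWithinAt, fun w hw h0 => ?_, ?_⟩
  · rw [hU] at hpU
    exact ⟨hpU.2, hφV (hU ▸ hpU)⟩
  · -- the derivative in the direction of the last coordinate is `-1`
    rw [(hder w hw).fderiv] at h0
    have := congrArg (fun L => L (e.symm (0, 1))) h0
    simp at this
  · ext w
    constructor
    · rintro ⟨⟨q, hq, rfl⟩, hw⟩
      have hqU : q ∈ U := hU ▸ ⟨hq, hw.1⟩
      refine ⟨hw, ?_⟩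
      have := hinv.1 hqU
      simp only at this
      simp [g, this]
    · rintro ⟨hw, h0⟩
      refine ⟨⟨ψ (e w).1, ?_, ?_⟩, hw⟩
      · have := hψU hw.2
        rw [hU] at this
        exact this.1
      · apply e.injective
        exact Prod.ext (hinv.2 hw.2) (sub_eq_zero.1 h0)

end IsotropicSphere

theorem mainTheorem5 (n : ℕ) (hn : 2 ≤ n)
    (A : Set (IsotropicSphere.RSpace n × IsotropicSphere.RSpace n))
    (hA : IsotropicSphere.IsOpenInTS A)
    (α δ σ : IsotropicSphere.RSpace n × IsotropicSphere.RSpace n → ℝ)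
    (hα : ContDiffOn ℝ ∞ α A) (hδ : ContDiffOn ℝ ∞ δ A) (hσ : ContDiffOn ℝ ∞ σ A)
    (hαδσ : ∀ p ∈ A, α p * δ p - σ p ^ 2 = 1)
    (hδ_pos : ∀ p ∈ A, 0 < δ p) :
    (IsotropicSphere.HasHolomorphicCharts (IsotropicSphere.isotropicJ α δ σ) A ↔
      IsotropicSphere.IsHolomorphicHypersurface
        ((fun p => IsotropicSphere.Phi p (IsotropicSphere.zFun δ σ p)) '' A)
        (IsotropicSphere.complexMinusReal n)) ∧
    (IsotropicSphere.IsInvolutive01 (IsotropicSphere.isotropicJ α δ σ) A ↔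
      IsotropicSphere.IsHolomorphicHypersurface
        ((fun p => IsotropicSphere.Phi p (IsotropicSphere.zFun δ σ p)) '' A)
        (IsotropicSphere.complexMinusReal n)) := by
  open IsotropicSphere in
  rw [image_Phi_eq hA]
  have hCI := isInvolutive01_of_hasHolomorphicCharts hA hα hδ hσ
  have hIH := graphMapHolomorphic_of_isInvolutive01 hn hA hα hδ hσ hδ_pos hαδσ
  have hHC := hasHolomorphicCharts_of_graphMapHolomorphic (α := α) hA hδ hσ hδ_pos
  have hHS := isHolomorphicHypersurface_of_graphMapHolomorphic (α := α) hA hδ hσ hδ_pos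
  have hSH := graphMapHolomorphic_of_isHolomorphicHypersurface hA hδ hσ hδ_pos hαδσ
  exact ⟨⟨fun h => hHS (hIH (hCI h)), fun h => hHC (hSH h)⟩,
    ⟨fun h => hHS (hIH h), fun h => hCI (hHC (hSH h))⟩⟩
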